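/- Let $n\ge 1$ be an integer, $p\in[1,\infty)$, $\alpha>0$ and $\lambda>0$. Let $$\Phi_\alpha(x,t)=\frac{t^{\alpha-1}}{\Gamma(\alpha)}\,\frac{1}{(4\pi t)^{n/2}}\,e^{-|x|^2/(4t)}\ \text{ for } t>0,\qquad \Phi_\alpha(x,t)=0\ \text{ for } t\le 0,\qquad x\in\mathbb{R}^n,$$ be the fractional heat kernel. For a nonnegative measurable function $f$ on $\mathbb{R}^n\times\mathbb{R}$ let $$J_\alpha f(x,t)=\iint_{\mathbb{R}^n\times(-\infty,t)}\Phi_\alpha(x-\xi,t-\tau)f(\xi,\tau)\,d\xi\,d\tau\in[0,\infty].$$ Let $X^p$ be the set of all measurable functions $f:\mathbb{R}^n\times\mathbb{R}\to\mathbb{R}$ such that $\|f\|_{L^p(\mathbb{R}^n\times(-\infty,T))}<\infty$ for all $T\in\mathbb{R}$. Equalities and inequalities between functions are understood almost everywhere, and a function is called nontrivial if it is not zero almost everywhere. Then there is a nontrivial nonnegative function $f\in X^p$ such that $$f\ge (J_\alpha f)^\lambda\ \text{ in } \mathbb{R}^n\times\mathbb{R},\qquad f=0\ \text{ in } \mathbb{R}^n\times(-\infty,0),$$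 if and only if $(\lambda,\alpha)\in B\cup D\cup E$, where \begin{align*} B&=\{(\lambda,\alpha):\lambda=1\text{ and }\alpha>0\},\\ D&=\left\{(\lambda,\alpha):\lambda>1\text{ and }\tfrac{n+2}{2p}\left(1-\tfrac1\lambda\right)\le\alpha<\tfrac{n+2}{2}\left(1-\tfrac1\lambda\right)\right\},\\ E&=\left\{(\lambda,\alpha):\lambda>1\text{ and }0<\alpha<\tfrac{n+2}{2p}\left(1-\tfrac1\lambda\right)\right\}. \end{align*} -/

import Mathlib

open MeasureTheory Set
open scoped ENNReal

noncomputable section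

namespace FracHeat

/-- Space-time `ℝⁿ × ℝ`; a point is a pair `(x, t)`. The space variable carries the Euclidean norm
and `volume` is Lebesgue measure. -/
abbrev SpaceTime (n : ℕ) : Type := EuclideanSpace ℝ (Fin n) × ℝ

/-- The fractional heat kernel `Φ_α(x, t)`; it vanishes for `t ≤ 0`. -/
def Phi (n : ℕ) (α : ℝ) (x : EuclideanSpace ℝ (Fin n)) (t : ℝ) : ℝ :=
  if 0 < t then
    t ^ (α - 1) / Real.Gamma α * (1 / (4 * Real.pi * t) ^ ((n : ℝ) / 2)) *
      Real.exp (-‖x‖ ^ 2 / (4 * t))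
  else 0

/-- `J_α f (x, t) = ∬_{ℝⁿ × (-∞, t)} Φ_α(x - ξ, t - τ) f(ξ, τ) dξ dτ`, for (almost everywhere)
nonnegative `f`, as a nonnegative extended real number. -/
def J (n : ℕ) (α : ℝ) (f : SpaceTime n → ℝ) (z : SpaceTime n) : ℝ≥0∞ :=
  ∫⁻ w in {w : SpaceTime n | w.2 < z.2}, ENNReal.ofReal (Phi n α (z.1 - w.1) (z.2 - w.2) * f w)

/-- `X^p`: the measurable `f : ℝⁿ × ℝ → ℝ` whose `L^p` norm over `ℝⁿ × (-∞, T)` is finite for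
every `T`. Measurable means Lebesgue measurable, that is, almost everywhere measurable. -/
def X (n : ℕ) (p : ℝ) : Set (SpaceTime n → ℝ) :=
  {f | AEStronglyMeasurable f volume ∧
    ∀ T : ℝ, MemLp f (ENNReal.ofReal p) (volume.restrict {w : SpaceTime n | w.2 < T})}

/-- `f` is a nonnegative solution of the super `J_α` problem: `f ≥ (J_α f)^lam` in `ℝⁿ × ℝ` and
`f = 0` in `ℝⁿ × (-∞, 0)`. All relations between functions hold almost everywhere. -/
structure IsNonnegSuperSolution (n : ℕ) (lam α : ℝ) (f : SpaceTime n → ℝ) : Prop where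
  nonneg : ∀ᵐ z : SpaceTime n, 0 ≤ f z
  super : ∀ᵐ z : SpaceTime n, J n α f z ^ lam ≤ ENNReal.ofReal (f z)
  initial : ∀ᵐ z : SpaceTime n, z.2 < 0 → f z = 0

/-- Points of the quadrant are pairs `(lam, α)`. -/
def regionB : Set (ℝ × ℝ) := {q | q.1 = 1 ∧ 0 < q.2}

def regionD (n : ℕ) (p : ℝ) : Set (ℝ × ℝ) :=
  {q | 1 < q.1 ∧ ((n : ℝ) + 2) / (2 * p) * (1 - 1 / q.1) ≤ q.2 ∧
    q.2 < ((n : ℝ) + 2) / 2 * (1 - 1 / q.1)}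

def regionE (n : ℕ) (p : ℝ) : Set (ℝ × ℝ) :=
  {q | 1 < q.1 ∧ 0 < q.2 ∧ q.2 < ((n : ℝ) + 2) / (2 * p) * (1 - 1 / q.1)}

end FracHeat

end

namespace FracHeat

/-! Since `p ≥ 1`, the regions `D` and `E` together are just `lam > 1`, `0 < α < (n+2)/2 * (1 -
1/lam)`; `p` does not affect the threshold.

Existence for `lam ≥ 1`: take `f = g(t) exp(-lam|x|²/(4(t+1)))` for `t > 0`. By the Gaussian
semigroup law `J f` is at most an amplitude times `exp(-|x|²/(4(t+1)))`, and the power `lam`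
restores the Gaussian of `f`. What remains is a Volterra inequality for `g`
(`exists_solution_of_amplitude`), solved by `(t+1)^(-n/2) e^t` when `lam = 1` and by a multiple of a
power of `t+1` in the subcritical range.

Nonexistence rests on the lower bound `exists_le_J`: some mass of a nontrivial `f` makes `J f` at
least a wide Gaussian with amplitude `t^(α-1-n/2)` at later times. For `lam < 1`, a lower bound `A
(t-t₁)^(α/(1-lam))` on a unit ball improves to one with `c A^lam`. Iteration forgets the initial
`A`, so `f ≥ δ` on a whole strip `ℝⁿ × (a, b)`, which contradicts `f ∈ X^p`. For `lam > 1` and `α`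
at or above the threshold, testing `J f ≤ f^(1/lam)` against powers of `R² - t` on a parabolic
cylinder and using Hölder bounds the integral of `f` uniformly in `R`, so `f` is integrable over `t
> 0`. But `f ≥ (J f)^lam` is at least a multiple of `t^(-(n+2)/2)` on a paraboloid, where the
integral diverges logarithmically. This also covers the critical case. -/

variable {n : ℕ} {α : ℝ}

/-! ### The kernel and Gaussian integrals. -/

theorem Phi_of_pos (x : EuclideanSpace ℝ (Fin n)) {t : ℝ} (ht : 0 < t) :
    Phi n α x t = t ^ (α - 1) / Real.Gamma α * (1 / (4 * Real.pi * t) ^ ((n : ℝ) / 2)) *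
      Real.exp (-‖x‖ ^ 2 / (4 * t)) := if_pos ht

theorem Phi_of_nonpos (x : EuclideanSpace ℝ (Fin n)) {t : ℝ} (ht : t ≤ 0) :
    Phi n α x t = 0 := if_neg ht.not_gt

theorem Phi_nonneg (hα : 0 < α) (x : EuclideanSpace ℝ (Fin n)) (t : ℝ) : 0 ≤ Phi n α x t := by
  rcases lt_or_ge 0 t with ht | ht
  · have := Real.Gamma_pos_of_pos hα
    rw [Phi_of_pos x ht]
    positivity
  · rw [Phi_of_nonpos x ht]

theorem measurable_Phi : Measurable fun z : SpaceTime n => Phi n α z.1 z.2 := by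
  unfold Phi
  refine Measurable.ite (measurableSet_lt measurable_const measurable_snd) ?_ measurable_const
  fun_prop

theorem measurable_ofReal_Phi_sub :
    Measurable fun q : SpaceTime n × SpaceTime n =>
      ENNReal.ofReal (Phi n α (q.1.1 - q.2.1) (q.1.2 - q.2.2)) :=
  (measurable_Phi.comp (f := fun q : SpaceTime n × SpaceTime n =>
    ((q.1.1 - q.2.1, q.1.2 - q.2.2) : SpaceTime n)) (by fun_prop)).ennreal_ofReal

theorem J_eq_lintegral (hα : 0 < α) (f : SpaceTime n → ℝ) (z : SpaceTime n) :
    J n α f z = ∫⁻ w, ENNReal.ofReal (Phi n α (z.1 - w.1) (z.2 - w.2)) * ENNReal.ofReal (f w) := by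
  have hm : MeasurableSet {w : SpaceTime n | w.2 < z.2} :=
    measurableSet_lt measurable_snd measurable_const
  rw [J, ← lintegral_indicator hm]
  refine lintegral_congr fun w => ?_
  by_cases hw : w.2 < z.2
  · rw [indicator_of_mem (by exact hw), ENNReal.ofReal_mul (Phi_nonneg hα _ _)]
  · rw [indicator_of_notMem (by exact hw), Phi_of_nonpos _ (by linarith)]
    simp

theorem lintegral_gaussian {b : ℝ} (hb : 0 < b) :
    ∫⁻ ξ : EuclideanSpace ℝ (Fin n), ENNReal.ofReal (Real.exp (-b * ‖ξ‖ ^ 2)) =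
      ENNReal.ofReal ((Real.pi / b) ^ ((n : ℝ) / 2)) := by
  have h := GaussianFourier.integral_rexp_neg_mul_sq_norm
    (V := EuclideanSpace ℝ (Fin n)) hb
  rw [finrank_euclideanSpace_fin] at h
  rw [← h, ofReal_integral_eq_lintegral_ofReal]
  -- The integral of a non-integrable function is `0` by convention, while `h` gives it a positive
  -- value.
  · by_contra hi
    rw [integral_undef hi] at h
    have : 0 < (Real.pi / b) ^ ((n : ℝ) / 2) := by positivity
    linarith
  · exact .of_forall fun _ => (Real.exp_pos _).le

/-- Completing the square in `ξ`; this is the algebra behind the heat semigroup law. -/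
theorem gaussian_exponent {x ξ : EuclideanSpace ℝ (Fin n)} {s r : ℝ} (hs : 0 < s) (hr : 0 < r) :
    -‖x - ξ‖ ^ 2 / (4 * s) + -‖ξ‖ ^ 2 / (4 * r) =
      -‖x‖ ^ 2 / (4 * (s + r)) + -((s + r) / (4 * s * r)) * ‖ξ - (r / (s + r)) • x‖ ^ 2 := by
  rw [norm_sub_sq_real, norm_sub_sq_real, inner_smul_right, norm_smul, real_inner_comm x ξ,
    mul_pow, Real.norm_eq_abs, sq_abs]
  field_simp
  ring

theorem lintegral_Phi_mul_gaussian (hα : 0 < α) (x : EuclideanSpace ℝ (Fin n)) {s r : ℝ}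
    (hs : 0 < s) (hr : 0 < r) :
    ∫⁻ ξ : EuclideanSpace ℝ (Fin n), ENNReal.ofReal (Phi n α (x - ξ) s) *
        ENNReal.ofReal (Real.exp (-‖ξ‖ ^ 2 / (4 * r))) =
      ENNReal.ofReal (s ^ (α - 1) / Real.Gamma α * (r / (s + r)) ^ ((n : ℝ) / 2) *
        Real.exp (-‖x‖ ^ 2 / (4 * (s + r)))) := by
  have hΓ := Real.Gamma_pos_of_pos hα
  set b := (s + r) / (4 * s * r) with hb
  have hb0 : 0 < b := by positivity
  set C := s ^ (α - 1) / Real.Gamma α * (1 / (4 * Real.pi * s) ^ ((n : ℝ) / 2)) *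
    Real.exp (-‖x‖ ^ 2 / (4 * (s + r))) with hC
  have hC0 : 0 ≤ C := by positivity
  have key : ∀ ξ : EuclideanSpace ℝ (Fin n), ENNReal.ofReal (Phi n α (x - ξ) s) *
      ENNReal.ofReal (Real.exp (-‖ξ‖ ^ 2 / (4 * r))) =
      ENNReal.ofReal C * ENNReal.ofReal (Real.exp (-b * ‖ξ - (r / (s + r)) • x‖ ^ 2)) := by
    intro ξ
    rw [← ENNReal.ofReal_mul (Phi_nonneg hα _ _), ← ENNReal.ofReal_mul hC0, Phi_of_pos _ hs,
      mul_assoc, ← Real.exp_add, gaussian_exponent hs hr, Real.exp_add, hC, hb]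
    congr 1
    ring
  simp_rw [key]
  rw [lintegral_const_mul' _ _ ENNReal.ofReal_ne_top,
    lintegral_sub_right_eq_self
      (fun ξ : EuclideanSpace ℝ (Fin n) => ENNReal.ofReal (Real.exp (-b * ‖ξ‖ ^ 2))),
    lintegral_gaussian hb0, ← ENNReal.ofReal_mul hC0]
  congr 1
  have h1 : Real.pi / b = (4 * Real.pi * s) * (r / (s + r)) := by
    rw [hb]; field_simp
  rw [h1, Real.mul_rpow (by positivity) (by positivity), hC]
  have h2 : 0 < (4 * Real.pi * s) ^ ((n : ℝ) / 2) := by positivity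
  field_simp

/-! ### Mass of the kernel in parabolic cylinders. -/

/-- A definite part of the heat that leaves a point of a ball stays in the ball, up to times of the
order of the radius squared. -/
theorem exists_le_lintegral_ball_Phi (n : ℕ) (hα : 0 < α) :
    ∃ c : ℝ, 0 < c ∧ ∀ (R s : ℝ) (x₀ x : EuclideanSpace ℝ (Fin n)), 0 < s → s ≤ R ^ 2 → 0 < R →
      x ∈ Metric.ball x₀ R →
      ENNReal.ofReal (c * s ^ (α - 1)) ≤
        ∫⁻ ξ in Metric.ball x₀ R, ENNReal.ofReal (Phi n α (x - ξ) s) := by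
  have hΓ := Real.Gamma_pos_of_pos hα
  set v : ℝ≥0∞ := volume (Metric.ball (0 : EuclideanSpace ℝ (Fin n)) 1) with hv
  have hv0 : 0 < v := Metric.measure_ball_pos _ _ one_pos
  have hvt : v ≠ ∞ := measure_ball_lt_top.ne
  have hvr : 0 < v.toReal := ENNReal.toReal_pos hv0.ne' hvt
  refine ⟨1 / Real.Gamma α * (1 / (4 * Real.pi) ^ ((n : ℝ) / 2)) * Real.exp (-(1 / 4)) *
    ((1 / 2) ^ n * v.toReal), by positivity, fun R s x₀ x hs hsR hR hx => ?_⟩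
  have hq : 0 < √s := Real.sqrt_pos.2 hs
  have hqR : √s ≤ R := Real.sqrt_le_iff.2 ⟨hR.le, hsR⟩
  have hxx : ‖x₀ - x‖ < R := by rwa [← dist_eq_norm, dist_comm]
  -- Even if `x` is close to the boundary, moving it towards the centre by at most `√s / 2` gives a
  -- ball of radius `√s / 2` inside the large ball. Its points are within `√s` of `x`, so the
  -- exponential there is at least `exp (-1/4)`.
  set y := x + (√s / (2 * R)) • (x₀ - x) with hy
  have h1 : dist y x ≤ √s / 2 := by
    rw [dist_eq_norm, hy, add_sub_cancel_left, norm_smul, Real.norm_of_nonneg (by positivity)]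
    calc √s / (2 * R) * ‖x₀ - x‖ ≤ √s / (2 * R) * R := by gcongr
      _ = √s / 2 := by field_simp
  have h2 : dist y x₀ ≤ R - √s / 2 := by
    have : y - x₀ = (-(1 - √s / (2 * R))) • (x₀ - x) := by
      rw [hy]; module
    have h3 : √s / (2 * R) ≤ 1 := by rw [div_le_one (by positivity)]; linarith
    rw [dist_eq_norm, this, norm_smul, norm_neg, Real.norm_of_nonneg (by linarith)]
    calc (1 - √s / (2 * R)) * ‖x₀ - x‖ ≤ (1 - √s / (2 * R)) * R := by
          gcongr
      _ = R - √s / 2 := by field_simp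
  have hsub : Metric.ball y (√s / 2) ⊆ Metric.ball x₀ R := Metric.ball_subset_ball' (by linarith)
  have hlow : ∀ ξ ∈ Metric.ball y (√s / 2),
      ENNReal.ofReal (s ^ (α - 1) / Real.Gamma α * (1 / (4 * Real.pi * s) ^ ((n : ℝ) / 2)) *
        Real.exp (-(1 / 4))) ≤ ENNReal.ofReal (Phi n α (x - ξ) s) := by
    intro ξ hξ
    rw [Phi_of_pos _ hs]
    refine ENNReal.ofReal_le_ofReal ?_
    gcongr
    have h4 : ‖x - ξ‖ ≤ √s := by
      rw [← dist_eq_norm, dist_comm]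
      have := dist_triangle ξ y x
      have := Metric.mem_ball.1 hξ
      linarith
    rw [neg_div, neg_le_neg_iff, div_le_iff₀ (by positivity)]
    have : ‖x - ξ‖ ^ 2 ≤ √s ^ 2 := by gcongr
    rw [Real.sq_sqrt hs.le] at this
    linarith
  refine le_trans ?_ (lintegral_mono_set hsub)
  refine le_trans ?_ (setLIntegral_mono' measurableSet_ball hlow)
  rw [setLIntegral_const, Measure.addHaar_ball_of_pos _ _ (by positivity),
    finrank_euclideanSpace_fin, ← hv, ← ENNReal.ofReal_toReal hvt,
    ← ENNReal.ofReal_mul (by positivity), ← ENNReal.ofReal_mul (by positivity),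
    ENNReal.toReal_ofReal (by positivity)]
  refine ENNReal.ofReal_le_ofReal (le_of_eq ?_)
  have h5 : s ^ ((n : ℝ) / 2) = √s ^ n := by
    rw [Real.sqrt_eq_rpow, ← Real.rpow_natCast, ← Real.rpow_mul hs.le]
    congr 1; ring
  rw [Real.mul_rpow (by positivity) hs.le, h5, div_pow, div_pow, one_pow]
  field_simp

theorem lintegral_Ioo_rpow (hα : 0 < α) {h : ℝ} (hh : 0 ≤ h) :
    ∫⁻ s in Ioo 0 h, ENNReal.ofReal (s ^ (α - 1)) = ENNReal.ofReal (h ^ α / α) := by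
  have hi := intervalIntegral.intervalIntegrable_rpow' (a := 0) (b := h) (r := α - 1) (by linarith)
  rw [intervalIntegrable_iff_integrableOn_Ioo_of_le hh] at hi
  rw [← ofReal_integral_eq_lintegral_ofReal hi, ← integral_Ioc_eq_integral_Ioo,
    ← intervalIntegral.integral_of_le hh, integral_rpow (.inl (by linarith))]
  · simp [Real.zero_rpow hα.ne']
  · exact (ae_restrict_iff' measurableSet_Ioo).2
      (.of_forall fun s hs => Real.rpow_nonneg hs.1.le _)

theorem exists_le_lintegral_cylinder_Phi (n : ℕ) (hα : 0 < α) :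
    ∃ c : ℝ, 0 < c ∧ ∀ (R h : ℝ) (x₀ x : EuclideanSpace ℝ (Fin n)), 0 < h → h ≤ R ^ 2 → 0 < R →
      x ∈ Metric.ball x₀ R →
      ENNReal.ofReal (c * h ^ α) ≤
        ∫⁻ w in Metric.ball x₀ R ×ˢ Ioo 0 h, ENNReal.ofReal (Phi n α (x - w.1) w.2) := by
  obtain ⟨c, hc, H⟩ := exists_le_lintegral_ball_Phi n hα
  refine ⟨c / α, by positivity, fun R h x₀ x hh hhR hR hx => ?_⟩
  rw [Measure.volume_eq_prod, ← Measure.prod_restrict, lintegral_prod_symm]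
  · calc ENNReal.ofReal (c / α * h ^ α)
        = ∫⁻ s in Ioo 0 h, ENNReal.ofReal (c * s ^ (α - 1)) := by
          simp_rw [ENNReal.ofReal_mul hc.le]
          rw [lintegral_const_mul' _ _ ENNReal.ofReal_ne_top, lintegral_Ioo_rpow hα hh.le,
            ← ENNReal.ofReal_mul hc.le]
          congr 1; ring
      _ ≤ _ := setLIntegral_mono' measurableSet_Ioo fun s hs =>
          H R s x₀ x hs.1 (hs.2.le.trans hhR) hR hx
  · exact (measurable_Phi.comp (f := fun w : SpaceTime n => ((x - w.1, w.2) : SpaceTime n))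
      (by fun_prop)).ennreal_ofReal.aemeasurable

theorem lintegral_prod_time_reflect {s : Set (EuclideanSpace ℝ (Fin n))} (hs : MeasurableSet s)
    (F : SpaceTime n → ℝ≥0∞) (hF : Measurable F) (h t : ℝ) :
    ∫⁻ w in s ×ˢ Ioo (t - h) t, F (w.1, t - w.2) = ∫⁻ w in s ×ˢ Ioo 0 h, F w := by
  rw [← lintegral_indicator (hs.prod measurableSet_Ioo),
    ← lintegral_indicator (hs.prod measurableSet_Ioo), Measure.volume_eq_prod, lintegral_prod,
    lintegral_prod]
  · refine lintegral_congr fun x => ?_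
    rw [← lintegral_sub_left_eq_self _ t]
    refine lintegral_congr fun τ => ?_
    have hmem : (x, t - τ) ∈ s ×ˢ Ioo (t - h) t ↔ (x, τ) ∈ s ×ˢ Ioo 0 h := by
      constructor <;> rintro ⟨h0, h1, h2⟩ <;>
        exact ⟨h0, by dsimp only at *; linarith, by dsimp only at *; linarith⟩
    by_cases hw : (x, τ) ∈ s ×ˢ Ioo 0 h
    · rw [indicator_of_mem hw, indicator_of_mem (hmem.2 hw), sub_sub_cancel]
    · rw [indicator_of_notMem hw, indicator_of_notMem (mt hmem.1 hw)]
  · exact (hF.indicator (hs.prod measurableSet_Ioo)).aemeasurable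
  · exact ((hF.comp (f := fun w : SpaceTime n => ((w.1, t - w.2) : SpaceTime n))
      (by fun_prop)).indicator (hs.prod measurableSet_Ioo)).aemeasurable

theorem lintegral_prod_time_shift {s : Set (EuclideanSpace ℝ (Fin n))} (hs : MeasurableSet s)
    (F : SpaceTime n → ℝ≥0∞) (hF : Measurable F) (h t : ℝ) :
    ∫⁻ w in s ×ˢ Ioo t (t + h), F (w.1, w.2 - t) = ∫⁻ w in s ×ˢ Ioo 0 h, F w := by
  rw [← lintegral_indicator (hs.prod measurableSet_Ioo),
    ← lintegral_indicator (hs.prod measurableSet_Ioo), Measure.volume_eq_prod, lintegral_prod,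
    lintegral_prod]
  · refine lintegral_congr fun x => ?_
    rw [eq_comm, ← lintegral_sub_right_eq_self _ t, eq_comm]
    refine lintegral_congr fun τ => ?_
    have hmem : (x, τ) ∈ s ×ˢ Ioo t (t + h) ↔ (x, τ - t) ∈ s ×ˢ Ioo 0 h := by
      constructor <;> rintro ⟨h0, h1, h2⟩ <;>
        exact ⟨h0, by dsimp only at *; linarith, by dsimp only at *; linarith⟩
    by_cases hw : (x, τ) ∈ s ×ˢ Ioo t (t + h)
    · rw [indicator_of_mem hw, indicator_of_mem (hmem.1 hw)]
    · rw [indicator_of_notMem hw, indicator_of_notMem (mt hmem.2 hw)]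
  · exact (hF.indicator (hs.prod measurableSet_Ioo)).aemeasurable
  · exact ((hF.comp (f := fun w : SpaceTime n => ((w.1, w.2 - t) : SpaceTime n))
      (by fun_prop)).indicator (hs.prod measurableSet_Ioo)).aemeasurable

/-- Lower bounds, with one constant, for the mass of `Φ_α` over a backward and over a forward
parabolic cylinder. -/
theorem exists_le_lintegral_cylinders (n : ℕ) (hα : 0 < α) :
    ∃ c : ℝ, 0 < c ∧ ∀ (R h t : ℝ) (x₀ x : EuclideanSpace ℝ (Fin n)), 0 < h → h ≤ R ^ 2 → 0 < R →
      x ∈ Metric.ball x₀ R →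
      ENNReal.ofReal (c * h ^ α) ≤ ∫⁻ w in Metric.ball x₀ R ×ˢ Ioo (t - h) t,
          ENNReal.ofReal (Phi n α (x - w.1) (t - w.2)) ∧
      ENNReal.ofReal (c * h ^ α) ≤ ∫⁻ w in Metric.ball x₀ R ×ˢ Ioo t (t + h),
          ENNReal.ofReal (Phi n α (w.1 - x) (w.2 - t)) := by
  obtain ⟨c, hc, H⟩ := exists_le_lintegral_cylinder_Phi n hα
  refine ⟨c, hc, fun R h t x₀ x hh hhR hR hx => ?_⟩
  have hm : Measurable fun w : SpaceTime n => ENNReal.ofReal (Phi n α (x - w.1) w.2) :=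
    (measurable_Phi.comp (f := fun w : SpaceTime n => ((x - w.1, w.2) : SpaceTime n))
      (by fun_prop)).ennreal_ofReal
  have hsymm : ∀ (ξ : EuclideanSpace ℝ (Fin n)) (s : ℝ),
      Phi n α (ξ - x) s = Phi n α (x - ξ) s := fun ξ s => by
    unfold Phi; rw [norm_sub_rev]
  simp_rw [hsymm]
  have h0 := H R h x₀ x hh hhR hR hx
  exact ⟨h0.trans_eq (lintegral_prod_time_reflect measurableSet_ball _ hm h t).symm,
    h0.trans_eq (lintegral_prod_time_shift measurableSet_ball _ hm h t).symm⟩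

/-- The logarithms of `s` and `t` differ by at most `log 2`, which treats both signs of `γ` at once.
-/
theorem rpow_comparable {t s : ℝ} (ht : 0 < t) (h₁ : t / 2 ≤ s) (h₂ : s ≤ 2 * t) (γ : ℝ) :
    (2 : ℝ) ^ (-|γ|) * t ^ γ ≤ s ^ γ ∧ s ^ γ ≤ (2 : ℝ) ^ |γ| * t ^ γ := by
  have hs : 0 < s := by linarith
  have hlog : |Real.log s - Real.log t| ≤ Real.log 2 := by
    rw [abs_le]
    constructor
    · have := Real.log_le_log (by positivity) h₁
      rw [Real.log_div ht.ne' two_ne_zero] at this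
      linarith
    · have := Real.log_le_log hs h₂
      rw [Real.log_mul two_ne_zero ht.ne'] at this
      linarith
  have hab : |γ * (Real.log s - Real.log t)| ≤ |γ| * Real.log 2 := by
    rw [abs_mul]; gcongr
  rw [abs_le] at hab
  simp only [Real.rpow_def_of_pos ht, Real.rpow_def_of_pos hs, Real.rpow_def_of_pos two_pos,
    ← Real.exp_add, Real.exp_le_exp]
  constructor <;> linarith

theorem lintegral_Ioo_reflect (F : ℝ → ℝ≥0∞) (t : ℝ) :
    ∫⁻ τ in Ioo 0 t, F (t - τ) = ∫⁻ τ in Ioo 0 t, F τ := by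
  rw [← lintegral_indicator measurableSet_Ioo, ← lintegral_indicator measurableSet_Ioo,
    eq_comm, ← lintegral_sub_left_eq_self _ t, eq_comm]
  refine lintegral_congr fun τ => ?_
  have hmem : τ ∈ Ioo 0 t ↔ t - τ ∈ Ioo 0 t := by
    constructor <;> rintro ⟨h1, h2⟩ <;> exact ⟨by linarith, by linarith⟩
  by_cases hw : τ ∈ Ioo 0 t
  · rw [indicator_of_mem hw, indicator_of_mem (hmem.1 hw)]
  · rw [indicator_of_notMem hw, indicator_of_notMem (mt hmem.2 hw)]

/-! ### Existence by Gaussian profiles. -/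

/-- A Gaussian profile in space, of width `√(t + 1)`, with amplitude `g` for positive times. -/
noncomputable def profile (n : ℕ) (lam : ℝ) (g : ℝ → ℝ) (z : SpaceTime n) : ℝ :=
  if 0 < z.2 then g z.2 * Real.exp (-(lam * ‖z.1‖ ^ 2) / (4 * (z.2 + 1))) else 0

theorem measurable_profile {lam : ℝ} {g : ℝ → ℝ} (hg : Measurable g) :
    Measurable (profile n lam g) := by
  unfold profile
  exact Measurable.ite (measurableSet_lt measurable_const measurable_snd) (by fun_prop)
    measurable_const

theorem J_profile_of_nonpos (hα : 0 < α) (lam : ℝ) (g : ℝ → ℝ) (x : EuclideanSpace ℝ (Fin n))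
    {t : ℝ} (ht : t ≤ 0) : J n α (profile n lam g) (x, t) = 0 := by
  rw [J_eq_lintegral hα]
  refine (lintegral_congr fun w => ?_).trans lintegral_zero
  rcases lt_or_ge 0 w.2 with hw | hw
  · rw [Phi_of_nonpos _ (by dsimp only; linarith)]
    simp
  · rw [profile, if_neg hw.not_gt]
    simp

/-- The slice at time `τ` is a Gaussian with parameter `(τ + 1) / lam`. Heat flow for time `t - τ`
adds `t - τ` to it, and `lam ≥ 1` keeps the sum at most `t + 1`, a bound free of `τ`. -/
theorem lintegral_Phi_mul_profile_le (hα : 0 < α) {lam : ℝ} (hlam : 1 ≤ lam) {g : ℝ → ℝ}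
    (hg : ∀ t, 0 < t → 0 ≤ g t) (x : EuclideanSpace ℝ (Fin n)) {t τ : ℝ} (hτ : 0 < τ)
    (hτt : τ < t) :
    ∫⁻ ξ : EuclideanSpace ℝ (Fin n), ENNReal.ofReal (Phi n α (x - ξ) (t - τ)) *
        ENNReal.ofReal (profile n lam g (ξ, τ)) ≤
      ENNReal.ofReal ((t + 1) ^ (-((n : ℝ) / 2)) * Real.exp (-‖x‖ ^ 2 / (4 * (t + 1)))) *
        ENNReal.ofReal ((t - τ) ^ (α - 1) / Real.Gamma α * ((τ + 1) ^ ((n : ℝ) / 2) * g τ)) := by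
  have hΓ := Real.Gamma_pos_of_pos hα
  have hlam0 : 0 < lam := by linarith
  have hs : 0 < t - τ := by linarith
  have ht : 0 < t + 1 := by linarith
  have hr : 0 < (τ + 1) / lam := by positivity
  have hgτ := hg τ hτ
  have e1 : ∀ ξ : EuclideanSpace ℝ (Fin n), ENNReal.ofReal (Phi n α (x - ξ) (t - τ)) *
      ENNReal.ofReal (profile n lam g (ξ, τ)) = ENNReal.ofReal (g τ) *
        (ENNReal.ofReal (Phi n α (x - ξ) (t - τ)) *
          ENNReal.ofReal (Real.exp (-‖ξ‖ ^ 2 / (4 * ((τ + 1) / lam))))) := by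
    intro ξ
    rw [profile, if_pos hτ, ENNReal.ofReal_mul hgτ, mul_left_comm]
    congr 4
    field_simp
  simp_rw [e1]
  rw [lintegral_const_mul' _ _ ENNReal.ofReal_ne_top, lintegral_Phi_mul_gaussian hα x hs hr,
    ← ENNReal.ofReal_mul hgτ, ← ENNReal.ofReal_mul (by positivity)]
  refine ENNReal.ofReal_le_ofReal ?_
  have hsr : t - τ + (τ + 1) / lam ≤ t + 1 := by
    have : (τ + 1) / lam ≤ τ + 1 := div_le_self (by linarith) hlam
    linarith
  have hratio : (τ + 1) / lam / (t - τ + (τ + 1) / lam) ≤ (τ + 1) / (t + 1) := by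
    rw [div_div]
    refine div_le_div_of_nonneg_left (by linarith) ht ?_
    rw [mul_add, mul_div_cancel₀ _ hlam0.ne']
    nlinarith
  have hexp : Real.exp (-‖x‖ ^ 2 / (4 * (t - τ + (τ + 1) / lam))) ≤
      Real.exp (-‖x‖ ^ 2 / (4 * (t + 1))) := by
    rw [Real.exp_le_exp, neg_div, neg_div, neg_le_neg_iff]
    gcongr
  calc g τ * ((t - τ) ^ (α - 1) / Real.Gamma α *
        ((τ + 1) / lam / (t - τ + (τ + 1) / lam)) ^ ((n : ℝ) / 2) *
        Real.exp (-‖x‖ ^ 2 / (4 * (t - τ + (τ + 1) / lam))))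
      ≤ g τ * ((t - τ) ^ (α - 1) / Real.Gamma α * ((τ + 1) / (t + 1)) ^ ((n : ℝ) / 2) *
        Real.exp (-‖x‖ ^ 2 / (4 * (t + 1)))) := by gcongr
    _ = _ := by
        rw [Real.div_rpow (by linarith) ht.le, Real.rpow_neg ht.le]
        ring

theorem J_profile_le (hα : 0 < α) {lam : ℝ} (hlam : 1 ≤ lam) {g : ℝ → ℝ} (hgm : Measurable g)
    (hg : ∀ t, 0 < t → 0 ≤ g t) (x : EuclideanSpace ℝ (Fin n)) (t : ℝ) :
    J n α (profile n lam g) (x, t) ≤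
      ENNReal.ofReal ((t + 1) ^ (-((n : ℝ) / 2)) * Real.exp (-‖x‖ ^ 2 / (4 * (t + 1)))) *
        ∫⁻ τ in Ioo 0 t, ENNReal.ofReal
          ((t - τ) ^ (α - 1) / Real.Gamma α * ((τ + 1) ^ ((n : ℝ) / 2) * g τ)) := by
  rw [J_eq_lintegral hα, Measure.volume_eq_prod, lintegral_prod_symm,
    ← lintegral_const_mul' _ _ ENNReal.ofReal_ne_top, ← lintegral_indicator measurableSet_Ioo]
  · refine lintegral_mono fun τ => ?_
    by_cases hτ : τ ∈ Ioo 0 t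
    · rw [indicator_of_mem hτ]
      exact lintegral_Phi_mul_profile_le hα hlam hg x hτ.1 hτ.2
    · rw [indicator_of_notMem hτ]
      refine le_of_eq ((lintegral_congr fun ξ => ?_).trans lintegral_zero)
      by_cases h0 : 0 < τ
      · have : t ≤ τ := not_lt.1 fun h => hτ ⟨h0, h⟩
        rw [Phi_of_nonpos _ (by dsimp only; linarith)]
        simp
      · rw [profile, if_neg h0]
        simp
  · exact ((measurable_ofReal_Phi_sub.comp (f := fun w : SpaceTime n => (((x, t), w) :
      SpaceTime n × SpaceTime n)) (by fun_prop)).mul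
      (measurable_profile hgm).ennreal_ofReal).aemeasurable

theorem integrable_gaussian {b : ℝ} (hb : 0 < b) :
    Integrable fun x : EuclideanSpace ℝ (Fin n) => Real.exp (-b * ‖x‖ ^ 2) := by
  refine ⟨by fun_prop, ?_⟩
  rw [hasFiniteIntegral_iff_ofReal (.of_forall fun _ => (Real.exp_pos _).le),
    lintegral_gaussian hb]
  exact ENNReal.ofReal_lt_top

theorem profile_mem_X {p lam : ℝ} (hp : 1 ≤ p) (hlam : 1 ≤ lam) {g : ℝ → ℝ}
    (hgm : Measurable g) (hg : ∀ t, 0 < t → 0 ≤ g t)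
    (hgb : ∀ T, ∃ C, ∀ t, 0 < t → t < T → g t ≤ C) :
    profile n lam g ∈ X n p := by
  have hm := measurable_profile (n := n) (lam := lam) hgm
  refine ⟨hm.aestronglyMeasurable, fun T => ?_⟩
  have hms : MeasurableSet {w : SpaceTime n | w.2 < T} :=
    measurableSet_lt measurable_snd measurable_const
  obtain ⟨C, hC⟩ := hgb T
  have hp0 : ENNReal.ofReal p ≠ 0 := by simp; linarith
  rw [← integrable_norm_rpow_iff hm.aestronglyMeasurable hp0 ENNReal.ofReal_ne_top,
    ENNReal.toReal_ofReal (by linarith)]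
  rcases le_or_gt T 0 with hT | hT
  · refine (integrable_zero _ _ _).congr ?_
    refine (ae_restrict_iff' hms).2 (.of_forall fun w hw => ?_)
    have : ¬ 0 < w.2 := by have : w.2 < T := hw; linarith
    change 0 = ‖profile n lam g w‖ ^ p
    rw [profile, if_neg this, norm_zero, Real.zero_rpow (by linarith)]
  have hC0 : 0 ≤ C := (hg (T / 2) (by linarith)).trans (hC _ (by linarith) (by linarith))
  -- The profile is widest at time `T`, so this Gaussian dominates every earlier slice.
  set b := lam * p / (4 * (T + 1)) with hb
  have hb0 : 0 < b := by positivity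
  have hdom : Integrable (fun w : SpaceTime n =>
      Real.exp (-b * ‖w.1‖ ^ 2) * (Ioo 0 T).indicator (fun _ => C ^ p) w.2) := by
    rw [Measure.volume_eq_prod]
    refine (integrable_gaussian hb0).mul_prod (f := fun x : EuclideanSpace ℝ (Fin n) =>
      Real.exp (-b * ‖x‖ ^ 2)) (g := (Ioo 0 T).indicator (fun _ => C ^ p)) ?_
    rw [integrable_indicator_iff measurableSet_Ioo]
    exact integrableOn_const (by simp)
  refine hdom.restrict.mono' (hm.norm.pow_const p).aestronglyMeasurable
    ((ae_restrict_iff' hms).2 (.of_forall fun w hw => ?_))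
  have hwT : w.2 < T := hw
  rw [Real.norm_of_nonneg (by positivity)]
  by_cases h0 : 0 < w.2
  · have hg0 := hg _ h0
    rw [profile, if_pos h0, indicator_of_mem (show w.2 ∈ Ioo 0 T from ⟨h0, hwT⟩),
      Real.norm_of_nonneg (by positivity), Real.mul_rpow hg0 (Real.exp_pos _).le, ← Real.exp_mul,
      mul_comm]
    have hgC := hC _ h0 hwT
    have hexp : -(lam * ‖w.1‖ ^ 2) / (4 * (w.2 + 1)) * p ≤ -b * ‖w.1‖ ^ 2 := by
      have h1 : 0 < 4 * (w.2 + 1) := by linarith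
      rw [hb, neg_div, neg_mul, neg_mul, neg_le_neg_iff, div_mul_eq_mul_div, div_mul_eq_mul_div,
        mul_right_comm]
      gcongr
    gcongr
  · rw [profile, if_neg h0, norm_zero, Real.zero_rpow (by linarith)]
    refine mul_nonneg (Real.exp_pos _).le (indicator_nonneg (fun _ _ => by positivity) _)

/-- The `lam` in the exponent of `profile` is exactly what the power `lam` of the Gaussian bounding
`J` produces. The space variable cancels and only the inequality `hsup` in time is left. -/
theorem exists_solution_of_amplitude {p lam : ℝ} (hp : 1 ≤ p) (hα : 0 < α) (hlam : 1 ≤ lam)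
    {g : ℝ → ℝ} (hgm : Measurable g) (hg : ∀ t, 0 < t → 0 < g t)
    (hgb : ∀ T, ∃ C, ∀ t, 0 < t → t < T → g t ≤ C)
    (hsup : ∀ t, 0 < t → (ENNReal.ofReal ((t + 1) ^ (-((n : ℝ) / 2))) * ∫⁻ τ in Ioo 0 t,
      ENNReal.ofReal ((t - τ) ^ (α - 1) / Real.Gamma α * ((τ + 1) ^ ((n : ℝ) / 2) * g τ))) ^ lam ≤
        ENNReal.ofReal (g t)) :
    ∃ f ∈ X n p, IsNonnegSuperSolution n lam α f ∧ ¬ (∀ᵐ z : SpaceTime n, f z = 0) := by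
  have hg' : ∀ t, 0 < t → 0 ≤ g t := fun t ht => (hg t ht).le
  refine ⟨profile n lam g, profile_mem_X hp hlam hgm hg' hgb, ⟨?_, ?_, ?_⟩, ?_⟩
  · refine .of_forall fun z => ?_
    unfold profile
    split_ifs with h
    · exact mul_nonneg (hg' _ h) (Real.exp_pos _).le
    · exact le_rfl
  · refine .of_forall fun ⟨x, t⟩ => ?_
    rcases le_or_gt t 0 with ht | ht
    · rw [J_profile_of_nonpos hα lam g x ht, ENNReal.zero_rpow_of_pos (by linarith)]
      exact zero_le
    · refine (ENNReal.rpow_le_rpow (J_profile_le hα hlam hgm hg' x t) (by linarith)).trans ?_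
      rw [profile, if_pos ht, ENNReal.ofReal_mul (hg' t ht), ENNReal.ofReal_mul (by positivity),
        mul_right_comm, ENNReal.mul_rpow_of_nonneg _ _ (by linarith : 0 ≤ lam),
        ENNReal.ofReal_rpow_of_pos (Real.exp_pos _), ← Real.exp_mul]
      refine mul_le_mul' (hsup t ht) (le_of_eq ?_)
      congr 2
      ring
  · refine .of_forall fun z hz => ?_
    rw [profile, if_neg hz.not_gt]
  · intro h
    have h0 : volume {z : SpaceTime n | 0 < z.2} = 0 := by
      refine measure_mono_null (fun z hz => ?_) (ae_iff.1 h)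
      have hz : 0 < z.2 := hz
      rw [mem_ofPred_eq, profile, if_pos hz]
      exact (mul_pos (hg _ hz) (Real.exp_pos _)).ne'
    have hopen : IsOpen {z : SpaceTime n | 0 < z.2} := isOpen_lt continuous_const continuous_snd
    exact (hopen.measure_pos volume ⟨(0, 1), by simp⟩).ne' h0

/-- The factor `(t+1)^(-n/2)` cancels the weights, and `e^t` is a supersolution of the remaining
fractional integral because the integral of `s^(α-1) e^(-s)` over `(0, ∞)` is `Γ(α)`. -/
theorem exists_solution_of_eq_one (n : ℕ) {p : ℝ} (hp : 1 ≤ p) (hα : 0 < α) :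
    ∃ f ∈ X n p, IsNonnegSuperSolution n 1 α f ∧ ¬ (∀ᵐ z : SpaceTime n, f z = 0) := by
  have hΓ := Real.Gamma_pos_of_pos hα
  refine exists_solution_of_amplitude (g := fun t => (t + 1) ^ (-((n : ℝ) / 2)) * Real.exp t)
    hp hα le_rfl (by fun_prop) (fun t ht => by positivity) (fun T => ⟨Real.exp T, ?_⟩) ?_
  · intro t ht htT
    have h1 : (t + 1) ^ (-((n : ℝ) / 2)) ≤ 1 :=
      Real.rpow_le_one_of_one_le_of_nonpos (by linarith) (by simp; positivity)
    calc _ ≤ 1 * Real.exp T := by gcongr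
      _ = _ := one_mul _
  · intro t ht
    rw [ENNReal.rpow_one, ENNReal.ofReal_mul (by positivity)]
    gcongr
    calc ∫⁻ τ in Ioo 0 t, ENNReal.ofReal ((t - τ) ^ (α - 1) / Real.Gamma α *
          ((τ + 1) ^ ((n : ℝ) / 2) * ((τ + 1) ^ (-((n : ℝ) / 2)) * Real.exp τ)))
        = ∫⁻ τ in Ioo 0 t, ENNReal.ofReal (Real.exp t / Real.Gamma α) *
            ENNReal.ofReal (Real.exp (-(t - τ)) * (t - τ) ^ (α - 1)) := by
          refine setLIntegral_congr_fun measurableSet_Ioo fun τ hτ => ?_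
          rw [← ENNReal.ofReal_mul (by positivity), ← mul_assoc ((τ + 1) ^ _),
            ← Real.rpow_add (by linarith [hτ.1]), add_neg_cancel, Real.rpow_zero, one_mul]
          congr 1
          rw [neg_sub, Real.exp_sub]
          field_simp
      _ = ∫⁻ τ in Ioo 0 t, ENNReal.ofReal (Real.exp t / Real.Gamma α) *
            ENNReal.ofReal (Real.exp (-τ) * τ ^ (α - 1)) :=
          lintegral_Ioo_reflect (fun s => ENNReal.ofReal (Real.exp t / Real.Gamma α) *
            ENNReal.ofReal (Real.exp (-s) * s ^ (α - 1))) t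
      _ ≤ ∫⁻ τ in Ioi 0, ENNReal.ofReal (Real.exp t / Real.Gamma α) *
            ENNReal.ofReal (Real.exp (-τ) * τ ^ (α - 1)) :=
          lintegral_mono_set Ioo_subset_Ioi_self
      _ = ENNReal.ofReal (Real.exp t) := by
          rw [lintegral_const_mul' _ _ ENNReal.ofReal_ne_top, ← ofReal_integral_eq_lintegral_ofReal
            (Real.GammaIntegral_convergent hα), ← Real.Gamma_eq_integral hα,
            ← ENNReal.ofReal_mul (by positivity), div_mul_cancel₀ _ hΓ.ne']
          exact (ae_restrict_iff' measurableSet_Ioi).2 (.of_forall fun s hs =>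
            mul_nonneg (Real.exp_pos _).le (Real.rpow_nonneg (le_of_lt hs) _))

theorem exists_lintegral_Ioo_rpow_mul_le (hα : 0 < α) {δ : ℝ} (hδ : 0 < δ) :
    ∃ C : ℝ, 0 < C ∧ ∀ t, 0 < t →
      ∫⁻ τ in Ioo 0 t, ENNReal.ofReal ((t - τ) ^ (α - 1) * (τ + 1) ^ (-1 - δ)) ≤
        ENNReal.ofReal (C * (t + 1) ^ (α - 1)) := by
  set K := (2 : ℝ) ^ |α - 1| with hK
  set M := (2 : ℝ) ^ |-1 - δ| with hM
  have hK0 : 0 < K := by positivity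
  have hM0 : 0 < M := by positivity
  refine ⟨K * (1 / δ) + M * (1 / α), by positivity, fun t ht => ?_⟩
  have ht1 : 0 < t + 1 := by linarith
  have hpt : ∀ τ ∈ Ioo 0 t, ENNReal.ofReal ((t - τ) ^ (α - 1) * (τ + 1) ^ (-1 - δ)) ≤
      ENNReal.ofReal (K * (t + 1) ^ (α - 1)) * ENNReal.ofReal ((τ + 1) ^ (-1 - δ)) +
      ENNReal.ofReal (M * (t + 1) ^ (-1 - δ)) * ENNReal.ofReal ((t - τ) ^ (α - 1)) := by
    rintro τ ⟨h0, h1⟩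
    have h2 : 0 < t - τ := by linarith
    rw [← ENNReal.ofReal_mul (by positivity), ← ENNReal.ofReal_mul (by positivity),
      ← ENNReal.ofReal_add (by positivity) (by positivity)]
    refine ENNReal.ofReal_le_ofReal ?_
    -- Either `t - τ` or `τ + 1` is comparable to `t + 1`, as they add up to it. That factor leaves
    -- the integral and the other one is integrated explicitly.
    rcases le_total ((t + 1) / 2) (t - τ) with h | h
    · have h3 := (rpow_comparable ht1 h (by linarith) (α - 1)).2
      refine le_add_of_le_of_nonneg ?_ (by positivity)
      gcongr
    · have h3 := (rpow_comparable ht1 (s := τ + 1) (by linarith) (by linarith) (-1 - δ)).2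
      refine le_add_of_nonneg_of_le (by positivity) ?_
      rw [mul_comm]
      gcongr
  have hI1 : ∫⁻ τ in Ioo 0 t, ENNReal.ofReal ((τ + 1) ^ (-1 - δ)) ≤ ENNReal.ofReal (1 / δ) := by
    have e : ∫⁻ τ in Ioi (0 : ℝ), ENNReal.ofReal ((τ + 1) ^ (-1 - δ)) =
        ∫⁻ τ in Ioi (1 : ℝ), ENNReal.ofReal (τ ^ (-1 - δ)) := by
      rw [← lintegral_indicator measurableSet_Ioi, ← lintegral_indicator measurableSet_Ioi,
        eq_comm, ← lintegral_add_right_eq_self _ (1 : ℝ), eq_comm]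
      refine lintegral_congr fun τ => ?_
      simp [indicator]
    refine (lintegral_mono_set Ioo_subset_Ioi_self).trans (e.trans_le ?_)
    rw [← ofReal_integral_eq_lintegral_ofReal
      (integrableOn_Ioi_rpow_of_lt (by linarith) one_pos), integral_Ioi_rpow_of_lt (by linarith)
      one_pos]
    · refine ENNReal.ofReal_le_ofReal (le_of_eq ?_)
      rw [Real.one_rpow, show -1 - δ + 1 = -δ by ring, neg_div_neg_eq]
    · exact (ae_restrict_iff' measurableSet_Ioi).2 (.of_forall fun s hs =>
        Real.rpow_nonneg (zero_le_one.trans (le_of_lt hs)) _)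
  have hI2 : ∫⁻ τ in Ioo 0 t, ENNReal.ofReal ((t - τ) ^ (α - 1)) = ENNReal.ofReal (t ^ α / α) := by
    rw [lintegral_Ioo_reflect (fun s => ENNReal.ofReal (s ^ (α - 1))), lintegral_Ioo_rpow hα ht.le]
  refine (setLIntegral_mono' measurableSet_Ioo hpt).trans ?_
  rw [lintegral_add_left (by fun_prop), lintegral_const_mul' _ _ ENNReal.ofReal_ne_top,
    lintegral_const_mul' _ _ ENNReal.ofReal_ne_top, hI2, add_mul,
    ENNReal.ofReal_add (by positivity) (by positivity)]
  gcongr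
  · refine (mul_le_mul' le_rfl hI1).trans_eq ?_
    rw [← ENNReal.ofReal_mul (by positivity), mul_right_comm]
  · rw [← ENNReal.ofReal_mul (by positivity)]
    refine ENNReal.ofReal_le_ofReal ?_
    have h4 : (t + 1) ^ (-1 - δ) * t ^ α ≤ (t + 1) ^ (α - 1) := by
      calc (t + 1) ^ (-1 - δ) * t ^ α ≤ (t + 1) ^ (-1 - δ) * (t + 1) ^ α := by
            gcongr; linarith
        _ = (t + 1) ^ (-1 - δ + α) := (Real.rpow_add ht1 _ _).symm
        _ ≤ _ := Real.rpow_le_rpow_of_exponent_le (by linarith) (by linarith)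
    calc M * (t + 1) ^ (-1 - δ) * (t ^ α / α) = M * (1 / α) * ((t + 1) ^ (-1 - δ) * t ^ α) := by
          ring
      _ ≤ _ := by gcongr

theorem exists_solution_of_subcritical (n : ℕ) {p lam : ℝ} (hp : 1 ≤ p) (hα : 0 < α)
    (hlam : 1 < lam) (hsub : α < ((n : ℝ) + 2) / 2 * (1 - 1 / lam)) :
    ∃ f ∈ X n p, IsNonnegSuperSolution n lam α f ∧ ¬ (∀ᵐ z : SpaceTime n, f z = 0) := by
  have hΓ := Real.Gamma_pos_of_pos hα
  -- With amplitude `(t+1)^(-(n/2+1+δ))`, the bound for `J` decays like `(t+1)^(α-1-n/2)`. Matching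
  -- its power `lam` with the amplitude forces this `δ`, and `δ > 0` is exactly subcriticality.
  set δ := lam * (((n : ℝ) + 2) / 2 - α) - ((n : ℝ) + 2) / 2 with hδ
  have hδ0 : 0 < δ := by
    have : α * lam < ((n : ℝ) + 2) / 2 * (1 - 1 / lam) * lam := by gcongr
    have h2 : ((n : ℝ) + 2) / 2 * (1 - 1 / lam) * lam = ((n : ℝ) + 2) / 2 * (lam - 1) := by
      field_simp
    rw [h2] at this
    rw [hδ]; linarith
  obtain ⟨C, hC, H⟩ := exists_lintegral_Ioo_rpow_mul_le hα hδ0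
  set D := C / Real.Gamma α with hD
  have hD0 : 0 < D := by positivity
  -- The positive solution of `(ε * D) ^ lam = ε`.
  set ε := D ^ (-(lam / (lam - 1))) with hε
  have hε0 : 0 < ε := by positivity
  have hεD : (ε * D) ^ lam = ε := by
    have : lam - 1 ≠ 0 := by linarith
    rw [Real.mul_rpow hε0.le hD0.le, hε, ← Real.rpow_mul hD0.le, ← Real.rpow_add hD0]
    congr 1
    field_simp
    ring
  set b := (n : ℝ) / 2 + 1 + δ with hb
  refine exists_solution_of_amplitude (g := fun t => ε * (t + 1) ^ (-b))
    hp hα hlam.le (by fun_prop) (fun t ht => by positivity) (fun T => ⟨ε, ?_⟩) ?_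
  · intro t ht htT
    refine mul_le_of_le_one_right hε0.le
      (Real.rpow_le_one_of_one_le_of_nonpos (by linarith) (neg_nonpos.2 (by positivity)))
  · intro t ht
    have ht1 : 0 < t + 1 := by linarith
    have hI : ∫⁻ τ in Ioo 0 t, ENNReal.ofReal ((t - τ) ^ (α - 1) / Real.Gamma α *
          ((τ + 1) ^ ((n : ℝ) / 2) * (ε * (τ + 1) ^ (-b)))) ≤
        ENNReal.ofReal (ε * D * (t + 1) ^ (α - 1)) := by
      calc ∫⁻ τ in Ioo 0 t, ENNReal.ofReal ((t - τ) ^ (α - 1) / Real.Gamma α *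
            ((τ + 1) ^ ((n : ℝ) / 2) * (ε * (τ + 1) ^ (-b))))
          = ∫⁻ τ in Ioo 0 t, ENNReal.ofReal (ε / Real.Gamma α) *
              ENNReal.ofReal ((t - τ) ^ (α - 1) * (τ + 1) ^ (-1 - δ)) := by
            refine setLIntegral_congr_fun measurableSet_Ioo fun τ hτ => ?_
            rw [← ENNReal.ofReal_mul (by positivity),
              show -1 - δ = (n : ℝ) / 2 + -b by rw [hb]; ring, Real.rpow_add (by linarith [hτ.1])]
            congr 1
            ring
        _ ≤ ENNReal.ofReal (ε / Real.Gamma α) * ENNReal.ofReal (C * (t + 1) ^ (α - 1)) := by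
            rw [lintegral_const_mul' _ _ ENNReal.ofReal_ne_top]
            gcongr
            exact H t ht
        _ = _ := by
            rw [← ENNReal.ofReal_mul (by positivity)]
            congr 1
            rw [hD]; ring
    refine (ENNReal.rpow_le_rpow (mul_le_mul' le_rfl hI) (by linarith)).trans ?_
    rw [← ENNReal.ofReal_mul (by positivity), ENNReal.ofReal_rpow_of_pos (by positivity)]
    refine ENNReal.ofReal_le_ofReal (le_of_eq ?_)
    rw [mul_left_comm, ← Real.rpow_add ht1, Real.mul_rpow (by positivity) (by positivity), hεD,
      ← Real.rpow_mul ht1.le]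
    congr 2
    rw [hb, hδ]; ring

/-! ### Lower bound for the potential of a nontrivial function. -/

theorem exists_setLIntegral_pos {f : SpaceTime n → ℝ} (hf : AEStronglyMeasurable f volume)
    (hnn : ∀ᵐ z : SpaceTime n, 0 ≤ f z) (h0 : ¬ ∀ᵐ z : SpaceTime n, f z = 0) :
    ∃ ρ m : ℝ, 0 < ρ ∧ 0 < m ∧ ENNReal.ofReal m ≤
      ∫⁻ w in Metric.ball 0 ρ ×ˢ Ioo (-ρ) ρ, ENNReal.ofReal (f w) := by
  set S : ℕ → Set (SpaceTime n) := fun k =>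
    Metric.ball 0 ((k : ℝ) + 1) ×ˢ Ioo (-((k : ℝ) + 1)) ((k : ℝ) + 1) with hS
  have hmono : Monotone S := fun i j hij => by
    have : (i : ℝ) ≤ j := by exact_mod_cast hij
    exact prod_mono (Metric.ball_subset_ball (by linarith))
      (Ioo_subset_Ioo (by linarith) (by linarith))
  have hU : ⋃ k, S k = univ := by
    refine eq_univ_of_forall fun w => ?_
    obtain ⟨k, hk⟩ := exists_nat_gt (max ‖w.1‖ |w.2|)
    rw [max_lt_iff, abs_lt] at hk
    exact mem_iUnion.2 ⟨k, by simpa using by linarith, by linarith, by linarith⟩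
  have hex : ∃ k, ∫⁻ w in S k, ENNReal.ofReal (f w) ≠ 0 := by
    by_contra! hall
    have h1 : ∫⁻ w, ENNReal.ofReal (f w) = 0 := by
      rw [← setLIntegral_univ, ← hU, setLIntegral_iUnion_of_directed _ hmono.directed_le]
      simp [hall]
    rw [lintegral_eq_zero_iff' hf.aemeasurable.ennreal_ofReal] at h1
    refine h0 ?_
    filter_upwards [h1, hnn] with z hz hz'
    exact le_antisymm (ENNReal.ofReal_eq_zero.1 hz) hz'
  obtain ⟨k, hk⟩ := hex
  -- The integral may be infinite, so a finite positive number below it is chosen.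
  obtain ⟨m, hm0, hm⟩ := ENNReal.lt_iff_exists_nnreal_btwn.1 (pos_iff_ne_zero.2 hk)
  refine ⟨(k : ℝ) + 1, m, by positivity, by exact_mod_cast hm0, ?_⟩
  rw [ENNReal.ofReal_coe_nnreal]
  exact hm.le

/-- Only the mass of `f` in a bounded cylinder is kept. For `t ≥ 2ρ` the elapsed times `t - τ` are
comparable to `t`, which gives the kernel its size there. -/
theorem exists_le_J (hα : 0 < α) {f : SpaceTime n → ℝ} (hf : AEStronglyMeasurable f volume)
    (hnn : ∀ᵐ z : SpaceTime n, 0 ≤ f z) (h0 : ¬ ∀ᵐ z : SpaceTime n, f z = 0) :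
    ∃ c ρ : ℝ, 0 < c ∧ 0 < ρ ∧ ∀ (x : EuclideanSpace ℝ (Fin n)) (t : ℝ), 2 * ρ ≤ t →
      ENNReal.ofReal (c * t ^ (α - 1 - (n : ℝ) / 2) * Real.exp (-(‖x‖ + ρ) ^ 2 / (2 * t))) ≤
        J n α f (x, t) := by
  obtain ⟨ρ, m, hρ, hm, hmass⟩ := exists_setLIntegral_pos hf hnn h0
  have hΓ := Real.Gamma_pos_of_pos hα
  refine ⟨(2 : ℝ) ^ (-|α - 1|) / Real.Gamma α * (1 / (8 * Real.pi) ^ ((n : ℝ) / 2)) * m, ρ,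
    by positivity, hρ, fun x t ht => ?_⟩
  have ht0 : 0 < t := by linarith
  set C := (2 : ℝ) ^ (-|α - 1|) * t ^ (α - 1) / Real.Gamma α *
    (1 / (8 * Real.pi * t) ^ ((n : ℝ) / 2)) * Real.exp (-(‖x‖ + ρ) ^ 2 / (2 * t)) with hC
  have hC0 : 0 < C := by positivity
  have hpt : ∀ w ∈ Metric.ball (0 : EuclideanSpace ℝ (Fin n)) ρ ×ˢ Ioo (-ρ) ρ,
      ENNReal.ofReal C * ENNReal.ofReal (f w) ≤
        ENNReal.ofReal (Phi n α (x - w.1) (t - w.2)) * ENNReal.ofReal (f w) := by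
    rintro ⟨ξ, τ⟩ ⟨hξ, hτ1, hτ2⟩
    dsimp only at hξ hτ1 hτ2 ⊢
    have hs : 0 < t - τ := by linarith
    gcongr
    rw [Phi_of_pos _ hs, hC]
    have h1 := (rpow_comparable ht0 (s := t - τ) (by linarith) (by linarith) (α - 1)).1
    have h2 : 4 * Real.pi * (t - τ) ≤ 8 * Real.pi * t := by nlinarith [Real.pi_pos]
    have h3 : ‖x - ξ‖ ≤ ‖x‖ + ρ := by
      have := norm_sub_le x ξ
      have := mem_ball_zero_iff.1 hξ
      linarith
    have h4 : -(‖x‖ + ρ) ^ 2 / (2 * t) ≤ -‖x - ξ‖ ^ 2 / (4 * (t - τ)) := by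
      rw [neg_div, neg_div, neg_le_neg_iff]
      exact div_le_div₀ (by positivity) (by gcongr) (by positivity) (by linarith)
    gcongr
  have hms : MeasurableSet (Metric.ball (0 : EuclideanSpace ℝ (Fin n)) ρ ×ˢ Ioo (-ρ) ρ) :=
    measurableSet_ball.prod measurableSet_Ioo
  rw [J_eq_lintegral hα]
  refine le_trans ?_ (setLIntegral_le_lintegral (Metric.ball 0 ρ ×ˢ Ioo (-ρ) ρ) _)
  refine le_trans ?_ (setLIntegral_mono' hms hpt)
  rw [lintegral_const_mul' _ _ ENNReal.ofReal_ne_top]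
  refine le_trans (le_of_eq ?_) (mul_le_mul' le_rfl hmass)
  rw [← ENNReal.ofReal_mul hC0.le, hC, Real.rpow_sub ht0 (α - 1),
    Real.mul_rpow (by positivity) ht0.le]
  congr 1
  field_simp

theorem IsNonnegSuperSolution.J_le {lam : ℝ} (hlam : 0 < lam) {f : SpaceTime n → ℝ}
    (hf : IsNonnegSuperSolution n lam α f) :
    ∀ᵐ z : SpaceTime n, J n α f z ≤ ENNReal.ofReal (f z) ^ lam⁻¹ := by
  filter_upwards [hf.super] with z hz
  exact (ENNReal.le_rpow_inv_iff hlam).2 hz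

/-! ### Nonexistence for `lam < 1`. -/

section Sublinear

/-- Self-improvement, for `lam < 1`, of lower bounds growing like a power of time. -/
theorem exists_le_J_improve (n : ℕ) (hα : 0 < α) {lam : ℝ} (hlam : 0 < lam) (hlam1 : lam < 1) :
    ∃ c : ℝ, 0 < c ∧ ∀ f : SpaceTime n → ℝ, IsNonnegSuperSolution n lam α f →
      ∀ (x₀ : EuclideanSpace ℝ (Fin n)) (t₁ A : ℝ), 0 < A →
      (∀ x ∈ Metric.ball x₀ 1, ∀ t ∈ Ioo t₁ (t₁ + 1),
        ENNReal.ofReal (A * (t - t₁) ^ (α / (1 - lam))) ≤ J n α f (x, t)) →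
      ∀ x ∈ Metric.ball x₀ 1, ∀ t ∈ Ioo t₁ (t₁ + 1),
        ENNReal.ofReal (c * A ^ lam * (t - t₁) ^ (α / (1 - lam))) ≤ J n α f (x, t) := by
  obtain ⟨c, hc, H⟩ := exists_le_lintegral_cylinders n hα
  -- The exponent with `K * lam + α = K`: the power `lam` followed by a gain of `α` from the kernel
  -- preserves it, so only the constant `A` changes.
  set K := α / (1 - lam) with hK
  have h1lam : 0 < 1 - lam := by linarith
  have hK0 : 0 < K := by positivity
  refine ⟨c * (1 / 2) ^ K, by positivity, fun f hf x₀ t₁ A hA hlow x hx t ht => ?_⟩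
  set h := (t - t₁) / 2 with hh
  have hh0 : 0 < h := by have := ht.1; linarith
  have hh1 : h ≤ 1 ^ 2 := by have := ht.2; linarith
  have hcyl := (H 1 h t x₀ x hh0 hh1 one_pos hx).1
  have hms : MeasurableSet (Metric.ball x₀ 1 ×ˢ Ioo (t - h) t) :=
    measurableSet_ball.prod measurableSet_Ioo
  have hpt : ∀ᵐ w : SpaceTime n, w ∈ Metric.ball x₀ 1 ×ˢ Ioo (t - h) t →
      ENNReal.ofReal ((A * h ^ K) ^ lam) * ENNReal.ofReal (Phi n α (x - w.1) (t - w.2)) ≤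
        ENNReal.ofReal (Phi n α (x - w.1) (t - w.2)) * ENNReal.ofReal (f w) := by
    filter_upwards [hf.super] with w hw hwm
    obtain ⟨hw1, hw2, hw3⟩ := hwm
    rw [mul_comm]
    refine mul_le_mul' le_rfl (le_trans ?_ hw)
    rw [← ENNReal.ofReal_rpow_of_pos (by positivity)]
    gcongr
    have h2 : w.2 ∈ Ioo t₁ (t₁ + 1) := ⟨by linarith, by linarith [ht.2]⟩
    refine le_trans (ENNReal.ofReal_le_ofReal ?_) (hlow w.1 hw1 w.2 h2)
    gcongr
    linarith
  rw [J_eq_lintegral hα]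
  refine le_trans ?_ (setLIntegral_le_lintegral (Metric.ball x₀ 1 ×ˢ Ioo (t - h) t) _)
  refine le_trans ?_ (setLIntegral_mono_ae' hms hpt)
  rw [lintegral_const_mul' _ _ ENNReal.ofReal_ne_top]
  refine le_trans (le_of_eq ?_) (mul_le_mul' le_rfl hcyl)
  have hKα : K * lam + α = K := by rw [hK]; field_simp; ring
  have e : h = 1 / 2 * (t - t₁) := by rw [hh]; ring
  rw [← ENNReal.ofReal_mul (by positivity), Real.mul_rpow hA.le (by positivity),
    ← Real.rpow_mul hh0.le]
  congr 1
  calc c * (1 / 2) ^ K * A ^ lam * (t - t₁) ^ K = c * A ^ lam * h ^ K := by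
        rw [e, Real.mul_rpow (by norm_num) (by linarith [ht.1])]; ring
    _ = c * A ^ lam * (h ^ (K * lam) * h ^ α) := by rw [← Real.rpow_add hh0, hKα]
    _ = _ := by ring

/-- A set of positive reals that is stable under `A ↦ c * A ^ lam`, `lam < 1`, has an element above
a threshold that depends on `c` and `lam` only. -/
theorem exists_ge_of_stable {c lam : ℝ} (hc : 0 < c) (hlam : 0 < lam) (hlam1 : lam < 1) {S : Set ℝ}
    (hne : S.Nonempty) (hpos : ∀ A ∈ S, 0 < A) (hst : ∀ A ∈ S, c * A ^ lam ∈ S) :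
    ∃ A ∈ S, (c * (1 / 2) ^ lam) ^ (1 / (1 - lam)) / 2 ≤ A := by
  by_cases hb : BddAbove S
  · set s := sSup S with hs
    have hs0 : 0 < s := by
      obtain ⟨A, hA⟩ := hne
      exact (hpos A hA).trans_le (le_csSup hb hA)
    -- An element above half the supremum, once mapped, still lies below the supremum: `c (s/2)^lam
    -- ≤ s`. This bounds `s` from below without a limit of iterates.
    obtain ⟨A, hA, hsA⟩ := exists_lt_of_lt_csSup hne (show s / 2 < sSup S by linarith)
    refine ⟨A, hA, le_trans ?_ hsA.le⟩
    have h1 : c * (1 / 2 * s) ^ lam ≤ s := by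
      refine le_trans ?_ (le_csSup hb (hst A hA))
      gcongr
      linarith
    have h2 : c * (1 / 2) ^ lam ≤ s ^ (1 - lam) := by
      rw [Real.rpow_sub hs0, Real.rpow_one, le_div_iff₀ (by positivity)]
      rw [Real.mul_rpow (by norm_num) hs0.le] at h1
      linarith
    have h3 : (c * (1 / 2) ^ lam) ^ (1 / (1 - lam)) ≤ s := by
      have h1lam : 0 < 1 - lam := by linarith
      calc (c * (1 / 2) ^ lam) ^ (1 / (1 - lam)) ≤ (s ^ (1 - lam)) ^ (1 / (1 - lam)) := by gcongr
        _ = s := by rw [← Real.rpow_mul hs0.le, mul_one_div_cancel h1lam.ne', Real.rpow_one]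
    linarith
  · obtain ⟨A, hA, hlt⟩ := not_bddAbove_iff.1 hb ((c * (1 / 2) ^ lam) ^ (1 / (1 - lam)) / 2)
    exact ⟨A, hA, hlt.le⟩

/-- The starting constant from `exists_le_J` decays with `x₀`, but the threshold `A₀` reached by
self-improvement does not depend on `x₀`. Hence the bound is uniform in space. -/
theorem exists_le_on_strip (hα : 0 < α) {lam : ℝ} (hlam : 0 < lam) (hlam1 : lam < 1)
    {f : SpaceTime n → ℝ} (hf : AEStronglyMeasurable f volume)
    (hsol : IsNonnegSuperSolution n lam α f) (h0 : ¬ ∀ᵐ z : SpaceTime n, f z = 0) :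
    ∃ a b δ : ℝ, a < b ∧ 0 < δ ∧ ∀ᵐ z : SpaceTime n, z.2 ∈ Ioo a b → δ ≤ f z := by
  obtain ⟨c, hc, himp⟩ := exists_le_J_improve n hα hlam hlam1
  obtain ⟨b, ρ, hb, hρ, hpos⟩ := exists_le_J hα hf hsol.nonneg h0
  set K := α / (1 - lam) with hK
  have hK0 : 0 < K := div_pos hα (by linarith)
  set A₀ := (c * (1 / 2) ^ lam) ^ (1 / (1 - lam)) / 2 with hA₀
  have hA₀0 : 0 < A₀ := by positivity
  set t₁ := 2 * ρ with ht₁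
  have ht₁0 : 0 < t₁ := by positivity
  have hJ : ∀ x₀ : EuclideanSpace ℝ (Fin n), ∀ t ∈ Ioo t₁ (t₁ + 1),
      ENNReal.ofReal (A₀ * (t - t₁) ^ K) ≤ J n α f (x₀, t) := by
    intro x₀ t ht
    set S : Set ℝ := {A | 0 < A ∧ ∀ x ∈ Metric.ball x₀ 1, ∀ t ∈ Ioo t₁ (t₁ + 1),
      ENNReal.ofReal (A * (t - t₁) ^ K) ≤ J n α f (x, t)} with hS
    have hne : S.Nonempty := by
      set γ := α - 1 - (n : ℝ) / 2 with hγ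
      refine ⟨b * min (t₁ ^ γ) ((t₁ + 1) ^ γ) *
        Real.exp (-(‖x₀‖ + 1 + ρ) ^ 2 / (2 * t₁)), by positivity, fun x hx s hs => ?_⟩
      have hs1 : s - t₁ ≤ 1 := by linarith [hs.2]
      have hs0 : 0 < s - t₁ := by linarith [hs.1]
      have hsp : 0 < s := ht₁0.trans hs.1
      refine le_trans (ENNReal.ofReal_le_ofReal ?_) (hpos x s hs.1.le)
      refine (mul_le_of_le_one_right (by positivity)
        (Real.rpow_le_one hs0.le hs1 hK0.le)).trans ?_
      have h1 : min (t₁ ^ γ) ((t₁ + 1) ^ γ) ≤ s ^ γ := by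
        rcases le_total 0 γ with hg | hg
        · exact (min_le_left _ _).trans (Real.rpow_le_rpow ht₁0.le hs.1.le hg)
        · exact (min_le_right _ _).trans
            (Real.rpow_le_rpow_of_nonpos (ht₁0.trans hs.1) hs.2.le hg)
      have h2 : ‖x‖ ≤ ‖x₀‖ + 1 := by
        have h3 := norm_le_norm_add_norm_sub' x x₀
        have h4 := Metric.mem_ball.1 hx
        rw [dist_eq_norm] at h4
        linarith
      have h5 : -(‖x₀‖ + 1 + ρ) ^ 2 / (2 * t₁) ≤ -(‖x‖ + ρ) ^ 2 / (2 * s) := by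
        rw [neg_div, neg_div, neg_le_neg_iff]
        have := hs.1.le
        gcongr
      gcongr
    obtain ⟨A, hA, hle⟩ := exists_ge_of_stable hc hlam hlam1 hne (fun A hA => hA.1)
      (fun A hA => ⟨by have := hA.1; positivity, himp f hsol x₀ t₁ A hA.1 hA.2⟩)
    refine le_trans (ENNReal.ofReal_le_ofReal ?_) (hA.2 x₀ (Metric.mem_ball_self one_pos) t ht)
    have : 0 ≤ (t - t₁) ^ K := Real.rpow_nonneg (by linarith [ht.1]) _
    gcongr
  -- The strip stays away from `t₁`, where the lower bound degenerates.
  refine ⟨t₁ + 1 / 2, t₁ + 1, (A₀ * (1 / 2) ^ K) ^ lam, by linarith, by positivity, ?_⟩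
  filter_upwards [hsol.super] with z hz hzt
  have h1 : ENNReal.ofReal (A₀ * (1 / 2) ^ K) ≤ J n α f z := by
    refine le_trans (ENNReal.ofReal_le_ofReal ?_) (hJ z.1 z.2 ⟨by linarith [hzt.1], hzt.2⟩)
    have := hzt.1
    gcongr
    linarith
  have h2 : ENNReal.ofReal ((A₀ * (1 / 2) ^ K) ^ lam) ≤ ENNReal.ofReal (f z) := by
    rw [← ENNReal.ofReal_rpow_of_pos (by positivity)]
    exact (ENNReal.rpow_le_rpow h1 hlam.le).trans hz
  exact (ENNReal.ofReal_le_ofReal_iff' (q := f z)).1 h2 |>.resolve_right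
    (not_le.2 (by positivity))

/-- As `n ≥ 1`, the strip has infinite measure, whereas a function in `L^p` exceeds `δ` only on a
set of finite measure. -/
theorem no_solution_of_lt_one (hn : 1 ≤ n) (hα : 0 < α) {p lam : ℝ} (hp : 1 ≤ p) (hlam : 0 < lam)
    (hlam1 : lam < 1) {f : SpaceTime n → ℝ} (hf : f ∈ X n p)
    (hsol : IsNonnegSuperSolution n lam α f) : ∀ᵐ z : SpaceTime n, f z = 0 := by
  by_contra h0
  obtain ⟨a, b, δ, hab, hδ, hle⟩ := exists_le_on_strip hα hlam hlam1 hf.1 hsol h0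
  have hp0 : ENNReal.ofReal p ≠ 0 := by simp; linarith
  have hfin := (hf.2 b).meas_ge_lt_top hp0 ENNReal.ofReal_ne_top
    (ε := δ.toNNReal) (by simpa using hδ)
  have : Nonempty (Fin n) := ⟨⟨0, hn⟩⟩
  have : NoncompactSpace (EuclideanSpace ℝ (Fin n)) := NormedSpace.noncompactSpace ℝ _
  have hvol : volume (univ ×ˢ Ioo a b : Set (SpaceTime n)) = ∞ := by
    rw [Measure.volume_eq_prod, Measure.prod_prod, measure_univ_of_isAddLeftInvariant,
      Real.volume_Ioo, ENNReal.top_mul (by simpa using hab)]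
  refine (lt_of_le_of_lt ?_ hfin).ne hvol
  have hms : MeasurableSet {w : SpaceTime n | w.2 < b} :=
    measurableSet_lt measurable_snd measurable_const
  rw [Measure.restrict_apply' hms]
  refine measure_mono_ae ?_
  filter_upwards [hle] with z hz hzm
  have hzt : z.2 ∈ Ioo a b := hzm.2
  refine ⟨?_, hzt.2⟩
  have h1 := hz hzt
  change δ.toNNReal ≤ ‖f z‖₊
  rw [Real.toNNReal_le_iff_le_coe, coe_nnnorm]
  exact h1.trans (Real.le_norm_self _)

end Sublinear

/-! ### Nonexistence for `lam > 1` at or above the critical `α`. -/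

section Superlinear

/-- The parabolic cylinder `B_R × (0, R²)`. -/
def cylinder (n : ℕ) (R : ℝ) : Set (SpaceTime n) := Metric.ball 0 R ×ˢ Ioo 0 (R ^ 2)

theorem measurableSet_cylinder (R : ℝ) : MeasurableSet (cylinder n R) :=
  measurableSet_ball.prod measurableSet_Ioo

theorem volume_cylinder {R : ℝ} (hR : 0 < R) :
    volume (cylinder n R) =
      ENNReal.ofReal (R ^ (n + 2)) * volume (Metric.ball (0 : EuclideanSpace ℝ (Fin n)) 1) := by
  rw [cylinder, Measure.volume_eq_prod, Measure.prod_prod, Measure.addHaar_ball_of_pos _ _ hR,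
    finrank_euclideanSpace_fin, Real.volume_Ioo, sub_zero, mul_right_comm,
    ← ENNReal.ofReal_mul (by positivity), ← pow_add]

theorem volume_cylinder_ne_top {R : ℝ} (hR : 0 < R) : volume (cylinder n R) ≠ ∞ := by
  rw [volume_cylinder hR]
  exact ENNReal.mul_ne_top ENNReal.ofReal_ne_top measure_ball_lt_top.ne

theorem lintegral_cylinder_lt_top {p : ℝ} (hp : 1 ≤ p) {f : SpaceTime n → ℝ} (hf : f ∈ X n p)
    {R : ℝ} (hR : 0 < R) : ∫⁻ z in cylinder n R, ENNReal.ofReal (f z) < ∞ := by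
  have : IsFiniteMeasure (volume.restrict (cylinder n R)) :=
    ⟨by rw [Measure.restrict_apply_univ]; exact (volume_cylinder_ne_top hR).lt_top⟩
  have h1 : MemLp f (ENNReal.ofReal p) (volume.restrict (cylinder n R)) :=
    (hf.2 (R ^ 2)).mono_measure (Measure.restrict_mono (fun z hz => hz.2.2) le_rfl)
  have h2 : Integrable f (volume.restrict (cylinder n R)) := h1.integrable (by simpa using hp)
  exact h2.lintegral_lt_top

/-- By Tonelli the kernel moves to the weight `(R² - t)^m`. Its mass in the forward cylinder
covering half the remaining time, where the weight is still comparable, raises the exponent by `α`.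
-/
theorem exists_le_lintegral_J_mul (n : ℕ) (hα : 0 < α) {m : ℝ} (hm : 0 ≤ m) :
    ∃ c : ℝ, 0 < c ∧ ∀ f : SpaceTime n → ℝ, AEStronglyMeasurable f volume → ∀ R : ℝ, 0 < R →
      ENNReal.ofReal c * ∫⁻ w in cylinder n R,
          ENNReal.ofReal (f w) * ENNReal.ofReal ((R ^ 2 - w.2) ^ (m + α)) ≤
        ∫⁻ z in cylinder n R, J n α f z * ENNReal.ofReal ((R ^ 2 - z.2) ^ m) := by
  obtain ⟨c, hc, H⟩ := exists_le_lintegral_cylinders n hα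
  refine ⟨c * (1 / 2) ^ (m + α), by positivity, fun f hf R hR => ?_⟩
  set T := R ^ 2 with hT
  set Q := cylinder n R with hQ
  have hQm : MeasurableSet Q := measurableSet_cylinder R
  have hfm : AEMeasurable (fun w => ENNReal.ofReal (f w)) (volume.restrict Q) :=
    hf.aemeasurable.ennreal_ofReal.restrict
  have hstep : ∀ w ∈ Q, ENNReal.ofReal (c * (1 / 2) ^ (m + α)) *
      (ENNReal.ofReal (f w) * ENNReal.ofReal ((T - w.2) ^ (m + α))) ≤
      ∫⁻ z in Q, ENNReal.ofReal (Phi n α (z.1 - w.1) (z.2 - w.2)) * ENNReal.ofReal (f w) *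
        ENNReal.ofReal ((T - z.2) ^ m) := by
    rintro ⟨y, τ⟩ ⟨hy, hτ0, hτT⟩
    dsimp only at hy hτ0 hτT ⊢
    set h := (T - τ) / 2 with hh
    have hh0 : 0 < h := by linarith
    have hcyl := (H R h τ 0 y hh0 (by linarith) hR hy).2
    set P : Set (SpaceTime n) := Metric.ball 0 R ×ˢ Ioo τ (τ + h) with hP
    have hPm : MeasurableSet P := measurableSet_ball.prod measurableSet_Ioo
    have hPQ : P ⊆ Q := prod_mono le_rfl (Ioo_subset_Ioo (by linarith) (by linarith))
    have hconst : c * (1 / 2) ^ (m + α) * (T - τ) ^ (m + α) = h ^ m * (c * h ^ α) := by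
      have e : h = 1 / 2 * (T - τ) := by rw [hh]; ring
      rw [mul_left_comm, ← Real.rpow_add hh0, e, Real.mul_rpow (by norm_num) (by linarith)]
      ring
    calc ENNReal.ofReal (c * (1 / 2) ^ (m + α)) *
          (ENNReal.ofReal (f (y, τ)) * ENNReal.ofReal ((T - τ) ^ (m + α)))
        = ENNReal.ofReal (f (y, τ)) * ENNReal.ofReal (h ^ m) * ENNReal.ofReal (c * h ^ α) := by
          rw [mul_left_comm, ← ENNReal.ofReal_mul (p := c * (1 / 2) ^ (m + α)) (by positivity),
            hconst, ENNReal.ofReal_mul (by positivity), mul_assoc]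
      _ ≤ ENNReal.ofReal (f (y, τ)) * ENNReal.ofReal (h ^ m) *
            ∫⁻ z in P, ENNReal.ofReal (Phi n α (z.1 - y) (z.2 - τ)) := mul_le_mul' le_rfl hcyl
      _ = ∫⁻ z in P, ENNReal.ofReal (f (y, τ)) * ENNReal.ofReal (h ^ m) *
            ENNReal.ofReal (Phi n α (z.1 - y) (z.2 - τ)) :=
          (lintegral_const_mul' _ _ (ENNReal.mul_ne_top ENNReal.ofReal_ne_top
            ENNReal.ofReal_ne_top)).symm
      _ ≤ ∫⁻ z in P, ENNReal.ofReal (Phi n α (z.1 - y) (z.2 - τ)) * ENNReal.ofReal (f (y, τ)) *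
            ENNReal.ofReal ((T - z.2) ^ m) := by
          refine setLIntegral_mono' hPm fun z hz => ?_
          have hz2 : z.2 < τ + h := hz.2.2
          rw [mul_right_comm, mul_comm (ENNReal.ofReal (f (y, τ)))]
          refine mul_le_mul' le_rfl (ENNReal.ofReal_le_ofReal ?_)
          exact Real.rpow_le_rpow hh0.le (by linarith) hm
      _ ≤ _ := lintegral_mono_set hPQ
  calc _ = ∫⁻ w in Q, ENNReal.ofReal (c * (1 / 2) ^ (m + α)) *
        (ENNReal.ofReal (f w) * ENNReal.ofReal ((T - w.2) ^ (m + α))) :=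
        (lintegral_const_mul' _ _ ENNReal.ofReal_ne_top).symm
    _ ≤ ∫⁻ w in Q, ∫⁻ z in Q, ENNReal.ofReal (Phi n α (z.1 - w.1) (z.2 - w.2)) *
          ENNReal.ofReal (f w) * ENNReal.ofReal ((T - z.2) ^ m) := setLIntegral_mono' hQm hstep
    _ = ∫⁻ z in Q, ∫⁻ w in Q, ENNReal.ofReal (Phi n α (z.1 - w.1) (z.2 - w.2)) *
          ENNReal.ofReal (f w) * ENNReal.ofReal ((T - z.2) ^ m) := by
        refine lintegral_lintegral_swap ?_
        simp only [Function.uncurry_def]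
        have hk : Measurable fun q : SpaceTime n × SpaceTime n =>
            ENNReal.ofReal (Phi n α (q.2.1 - q.1.1) (q.2.2 - q.1.2)) :=
          measurable_ofReal_Phi_sub.comp measurable_swap
        exact (hk.aemeasurable.mul hfm.comp_fst).mul (Measurable.aemeasurable (by fun_prop))
    _ ≤ _ := by
        refine lintegral_mono fun z => ?_
        rw [lintegral_mul_const' _ _ ENNReal.ofReal_ne_top, J_eq_lintegral hα]
        exact mul_le_mul' (setLIntegral_le_lintegral _ _) le_rfl

theorem lintegral_rpow_inv_mul_le {Ω : Type*} [MeasurableSpace Ω] {μ : Measure Ω} {lam : ℝ}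
    (hlam : 1 < lam) {g ψ : Ω → ℝ≥0∞} (hg : AEMeasurable g μ) (hψ : AEMeasurable ψ μ) :
    ∫⁻ z, g z ^ lam⁻¹ * ψ z ∂μ ≤
      (∫⁻ z, g z * ψ z ^ lam ∂μ) ^ (1 / lam) * μ univ ^ (1 - 1 / lam) := by
  have hpq : lam.HolderConjugate (lam / (lam - 1)) := Real.HolderConjugate.conjExponent hlam
  have h := ENNReal.lintegral_mul_le_Lp_mul_Lq μ hpq (f := fun z => g z ^ lam⁻¹ * ψ z)
    (g := fun _ => 1) ((hg.pow_const _).mul hψ) aemeasurable_const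
  have e : 1 / (lam / (lam - 1)) = 1 - 1 / lam := by
    have : lam - 1 ≠ 0 := by linarith
    field_simp
  have e2 : ∀ z, (g z ^ lam⁻¹ * ψ z) ^ lam = g z * ψ z ^ lam := fun z => by
    rw [ENNReal.mul_rpow_of_nonneg _ _ (by linarith), ← ENNReal.rpow_mul,
      inv_mul_cancel₀ (by linarith), ENNReal.rpow_one]
  simpa [e, e2] using h

/-- Absorption of `G^(1/lam)` into the left side; this is where finiteness of `G` matters. -/
theorem le_of_mul_le_rpow_mul_rpow {c lam : ℝ} (hc : 0 < c) (hlam : 1 < lam) {G V : ℝ≥0∞}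
    (hG : G ≠ ∞) (hV : V ≠ ∞)
    (h : ENNReal.ofReal c * G ≤ G ^ (1 / lam) * V ^ (1 - 1 / lam)) :
    G ≤ ENNReal.ofReal (c⁻¹ ^ (lam / (lam - 1))) * V := by
  have hθ : 0 < 1 - 1 / lam := by
    rw [sub_pos, div_lt_one (by linarith)]; exact hlam
  lift G to NNReal using hG
  lift V to NNReal using hV
  rcases eq_or_ne G 0 with rfl | hG0
  · simp
  have hGp : 0 < (G : ℝ) := by positivity
  rw [← ENNReal.ofReal_coe_nnreal, ← ENNReal.ofReal_coe_nnreal (p := V),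
    ENNReal.ofReal_rpow_of_pos hGp, ENNReal.ofReal_rpow_of_nonneg V.coe_nonneg hθ.le,
    ← ENNReal.ofReal_mul hc.le, ← ENNReal.ofReal_mul (by positivity),
    ENNReal.ofReal_le_ofReal_iff (by positivity)] at h
  rw [← ENNReal.ofReal_coe_nnreal, ← ENNReal.ofReal_coe_nnreal (p := V),
    ← ENNReal.ofReal_mul (by positivity)]
  refine ENNReal.ofReal_le_ofReal ?_
  have h1 : c * (G : ℝ) ^ (1 - 1 / lam) ≤ (V : ℝ) ^ (1 - 1 / lam) := by
    have hp : 0 < (G : ℝ) ^ (1 / lam) := by positivity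
    refine le_of_mul_le_mul_left ?_ hp
    calc (G : ℝ) ^ (1 / lam) * (c * (G : ℝ) ^ (1 - 1 / lam))
        = c * ((G : ℝ) ^ (1 / lam) * (G : ℝ) ^ (1 - 1 / lam)) := by ring
      _ = c * (G : ℝ) := by rw [← Real.rpow_add hGp, add_sub_cancel, Real.rpow_one]
      _ ≤ _ := h
  have e : (1 - 1 / lam) * (lam / (lam - 1)) = 1 := by
    have : lam - 1 ≠ 0 := by linarith
    field_simp
  have hq : 0 < lam / (lam - 1) := div_pos (by linarith) (by linarith)
  have h2 : (G : ℝ) ^ (1 - 1 / lam) ≤ c⁻¹ * (V : ℝ) ^ (1 - 1 / lam) := by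
    rw [inv_mul_eq_div, le_div_iff₀ hc]; linarith
  calc (G : ℝ) = ((G : ℝ) ^ (1 - 1 / lam)) ^ (lam / (lam - 1)) := by
        rw [← Real.rpow_mul hGp.le, e, Real.rpow_one]
    _ ≤ (c⁻¹ * (V : ℝ) ^ (1 - 1 / lam)) ^ (lam / (lam - 1)) := by gcongr
    _ = _ := by
        rw [Real.mul_rpow (by positivity) (by positivity), ← Real.rpow_mul V.coe_nonneg, e, Real.rpow_one]

theorem exists_lintegral_cylinder_weight_le (n : ℕ) (hα : 0 < α) {lam : ℝ} (hlam : 1 < lam) :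
    ∃ C : ℝ, 0 < C ∧ ∀ (p : ℝ) (f : SpaceTime n → ℝ), 1 ≤ p → f ∈ X n p →
      IsNonnegSuperSolution n lam α f → ∀ R : ℝ, 0 < R →
      ∫⁻ w in cylinder n R, ENNReal.ofReal (f w) *
          ENNReal.ofReal ((R ^ 2 - w.2) ^ (α * lam / (lam - 1))) ≤
        ENNReal.ofReal C * volume (cylinder n R) := by
  have hl : 0 < lam - 1 := by linarith
  -- Chosen so that `m * lam = m + α`: the weighted integral produced by Hölder is then the one on
  -- the left, and it can be absorbed.
  set m := α / (lam - 1) with hm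
  have hm0 : 0 < m := by positivity
  have hmα : m + α = α * lam / (lam - 1) := by rw [hm]; field_simp; ring
  have hml : α * lam / (lam - 1) = m * lam := by rw [hm]; ring
  obtain ⟨c, hc, H⟩ := exists_le_lintegral_J_mul n hα hm0.le
  refine ⟨c⁻¹ ^ (lam / (lam - 1)), by positivity, fun p f hp hf hsol R hR => ?_⟩
  have hfin : ∫⁻ w in cylinder n R, ENNReal.ofReal (f w) *
      ENNReal.ofReal ((R ^ 2 - w.2) ^ (α * lam / (lam - 1))) ≠ ∞ := by
    refine ne_top_of_le_ne_top (ENNReal.mul_ne_top (lintegral_cylinder_lt_top hp hf hR).ne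
      (ENNReal.ofReal_ne_top (r := (R ^ 2) ^ (α * lam / (lam - 1))))) ?_
    rw [← lintegral_mul_const' _ _ ENNReal.ofReal_ne_top]
    refine setLIntegral_mono' (measurableSet_cylinder R) fun w hw => ?_
    have h1 : 0 < w.2 := hw.2.1
    have h2 : w.2 < R ^ 2 := hw.2.2
    gcongr
    linarith
  refine le_of_mul_le_rpow_mul_rpow hc hlam hfin (volume_cylinder_ne_top hR) ?_
  have h1 := H f hf.1 R hR
  rw [hmα] at h1
  refine h1.trans ?_
  have h2 : ∫⁻ z in cylinder n R, J n α f z * ENNReal.ofReal ((R ^ 2 - z.2) ^ m) ≤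
      ∫⁻ z in cylinder n R, ENNReal.ofReal (f z) ^ lam⁻¹ *
        ENNReal.ofReal ((R ^ 2 - z.2) ^ m) := by
    refine lintegral_mono_ae (ae_restrict_of_ae ?_)
    filter_upwards [hsol.J_le (by linarith)] with z hz
    gcongr
  refine h2.trans ?_
  refine (lintegral_rpow_inv_mul_le hlam hf.1.aemeasurable.ennreal_ofReal.restrict
    (Measurable.aemeasurable (by fun_prop))).trans (le_of_eq ?_)
  rw [Measure.restrict_apply_univ]
  congr 2
  refine setLIntegral_congr_fun (measurableSet_cylinder R) fun w hw => ?_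
  have h3 : 0 < R ^ 2 - w.2 := sub_pos.2 hw.2.2
  rw [ENNReal.ofReal_rpow_of_pos (by positivity), ← Real.rpow_mul h3.le, hml]

/-- On the lower half the weight is at least `(R²/2)^q`, while the volume grows like `R^(n+2)`. The
hypothesis `hsup` amounts to `n + 2 ≤ 2q`, so the quotient stays bounded for `R ≥ 1`. -/
theorem exists_lintegral_half_cylinder_le (hα : 0 < α) {p lam : ℝ} (hp : 1 ≤ p) (hlam : 1 < lam)
    (hsup : ((n : ℝ) + 2) / 2 * (1 - 1 / lam) ≤ α) {f : SpaceTime n → ℝ} (hf : f ∈ X n p)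
    (hsol : IsNonnegSuperSolution n lam α f) :
    ∃ C : ℝ≥0∞, C ≠ ∞ ∧ ∀ R : ℝ, 1 ≤ R →
      ∫⁻ w in Metric.ball 0 R ×ˢ Ioo 0 (R ^ 2 / 2), ENNReal.ofReal (f w) ≤ C := by
  obtain ⟨C, hC, H⟩ := exists_lintegral_cylinder_weight_le n hα hlam
  have hl : 0 < lam - 1 := by linarith
  set q := α * lam / (lam - 1) with hq
  have hq0 : 0 < q := by positivity
  have hqn : (n : ℝ) + 2 ≤ 2 * q := by
    rw [hq, ← mul_div_assoc, le_div_iff₀ hl]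
    have : ((n : ℝ) + 2) / 2 * (1 - 1 / lam) * lam ≤ α * lam := by gcongr
    have h2 : ((n : ℝ) + 2) / 2 * (1 - 1 / lam) * lam = ((n : ℝ) + 2) / 2 * (lam - 1) := by
      field_simp
    linarith
  set v := volume (Metric.ball (0 : EuclideanSpace ℝ (Fin n)) 1) with hv
  refine ⟨ENNReal.ofReal (2 ^ q * C) * v,
    ENNReal.mul_ne_top ENNReal.ofReal_ne_top measure_ball_lt_top.ne, fun R hR => ?_⟩
  have hR0 : 0 < R := by linarith
  set Q' : Set (SpaceTime n) := Metric.ball 0 R ×ˢ Ioo 0 (R ^ 2 / 2) with hQ'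
  have hQ'm : MeasurableSet Q' := measurableSet_ball.prod measurableSet_Ioo
  have hsub : Q' ⊆ cylinder n R :=
    prod_mono le_rfl (Ioo_subset_Ioo le_rfl (by linarith [sq_nonneg R]))
  have h1 : (∫⁻ w in Q', ENNReal.ofReal (f w)) * ENNReal.ofReal ((R ^ 2 / 2) ^ q) ≤
      ENNReal.ofReal C * (ENNReal.ofReal (R ^ (n + 2)) * v) := by
    rw [← volume_cylinder hR0, ← lintegral_mul_const' _ _ ENNReal.ofReal_ne_top]
    refine le_trans ?_ (H p f hp hf hsol R hR0)
    refine le_trans ?_ (lintegral_mono_set hsub)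
    refine setLIntegral_mono' hQ'm fun w hw => ?_
    have h2 : w.2 < R ^ 2 / 2 := hw.2.2
    gcongr
    linarith
  have hpos : 0 < (R ^ 2 / 2) ^ q := by positivity
  have h3 : ENNReal.ofReal ((R ^ 2 / 2) ^ q) ≠ 0 := by simpa using hpos
  refine (ENNReal.mul_le_mul_iff_left h3 ENNReal.ofReal_ne_top).1 (h1.trans ?_)
  rw [← mul_assoc, mul_right_comm _ v, ← ENNReal.ofReal_mul hC.le, ← ENNReal.ofReal_mul (by positivity)]
  refine mul_le_mul' (ENNReal.ofReal_le_ofReal ?_) le_rfl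
  have h4 : R ^ (n + 2) ≤ (R ^ 2) ^ q := by
    rw [← Real.rpow_natCast, ← Real.rpow_natCast R 2, ← Real.rpow_mul hR0.le]
    refine Real.rpow_le_rpow_of_exponent_le hR ?_
    push_cast
    linarith
  rw [Real.div_rpow (by positivity) two_pos.le]
  calc C * R ^ (n + 2) ≤ C * (R ^ 2) ^ q := by gcongr
    _ = _ := by field_simp

theorem lintegral_time_pos_lt_top (hα : 0 < α) {p lam : ℝ} (hp : 1 ≤ p) (hlam : 1 < lam)
    (hsup : ((n : ℝ) + 2) / 2 * (1 - 1 / lam) ≤ α) {f : SpaceTime n → ℝ} (hf : f ∈ X n p)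
    (hsol : IsNonnegSuperSolution n lam α f) :
    ∫⁻ w in {w : SpaceTime n | 0 < w.2}, ENNReal.ofReal (f w) < ∞ := by
  obtain ⟨C, hC, H⟩ := exists_lintegral_half_cylinder_le hα hp hlam hsup hf hsol
  set S : ℕ → Set (SpaceTime n) := fun k =>
    Metric.ball 0 ((k : ℝ) + 1) ×ˢ Ioo 0 (((k : ℝ) + 1) ^ 2 / 2) with hS
  have hmono : Monotone S := fun i j hij => by
    have : (i : ℝ) ≤ j := by exact_mod_cast hij
    exact prod_mono (Metric.ball_subset_ball (by linarith))
      (Ioo_subset_Ioo le_rfl (by gcongr))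
  have hU : {w : SpaceTime n | 0 < w.2} ⊆ ⋃ k, S k := by
    intro w hw
    obtain ⟨k, hk⟩ := exists_nat_gt (max ‖w.1‖ w.2)
    rw [max_lt_iff] at hk
    refine mem_iUnion.2 ⟨k, mem_ball_zero_iff.2 (by linarith), hw, ?_⟩
    nlinarith [hk.2, sq_nonneg (k : ℝ)]
  refine (lintegral_mono_set hU).trans_lt ?_
  rw [setLIntegral_iUnion_of_directed _ hmono.directed_le]
  exact (iSup_le fun k => H _ (by simp)).trans_lt hC.lt_top

theorem lintegral_Ioi_inv_eq_top {a : ℝ} (ha : 0 ≤ a) :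
    ∫⁻ t in Ioi a, ENNReal.ofReal t⁻¹ = ∞ := by
  by_contra h
  refine not_integrableOn_Ioi_inv (a := a) ⟨by fun_prop, ?_⟩
  rw [hasFiniteIntegral_iff_ofReal]
  · exact lt_top_iff_ne_top.2 h
  · exact (ae_restrict_iff' measurableSet_Ioi).2 (.of_forall fun t ht =>
      inv_nonneg.2 (ha.trans (le_of_lt ht)))

/-- Functions that decay like the critical power on a paraboloid are not integrable. -/
theorem lintegral_paraboloid_eq_top (n : ℕ) {a c : ℝ} (ha : 0 < a) (hc : 0 < c) :
    ∫⁻ w in {w : SpaceTime n | a < w.2 ∧ ‖w.1‖ < √w.2},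
      ENNReal.ofReal (c * w.2 ^ (-(((n : ℝ) + 2) / 2))) = ∞ := by
  have hms : MeasurableSet {w : SpaceTime n | a < w.2 ∧ ‖w.1‖ < √w.2} :=
    (measurableSet_lt measurable_const measurable_snd).inter
      (measurableSet_lt measurable_fst.norm measurable_snd.sqrt)
  set v := volume (Metric.ball (0 : EuclideanSpace ℝ (Fin n)) 1) with hv
  have hv0 : 0 < v := Metric.measure_ball_pos _ _ one_pos
  rw [← lintegral_indicator hms, Measure.volume_eq_prod, lintegral_prod_symm]
  · refine top_le_iff.1 ?_
    calc ∞ = ENNReal.ofReal c * v * ∫⁻ t in Ioi a, ENNReal.ofReal t⁻¹ := by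
          rw [lintegral_Ioi_inv_eq_top ha.le, ENNReal.mul_top]
          exact mul_ne_zero (by simpa using hc) hv0.ne'
      _ = ∫⁻ t, (Ioi a).indicator (fun t => ENNReal.ofReal c * v * ENNReal.ofReal t⁻¹) t := by
          rw [lintegral_indicator measurableSet_Ioi, lintegral_const_mul _ (by fun_prop)]
      _ ≤ _ := by
          refine lintegral_mono fun t => ?_
          by_cases ht : t ∈ Ioi a
          · have hat : a < t := ht
            have ht0 : 0 < t := ha.trans hat
            have e : ∀ x : EuclideanSpace ℝ (Fin n),
                {w : SpaceTime n | a < w.2 ∧ ‖w.1‖ < √w.2}.indicator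
                  (fun w => ENNReal.ofReal (c * w.2 ^ (-(((n : ℝ) + 2) / 2)))) (x, t) =
                (Metric.ball 0 (√t)).indicator
                  (fun _ => ENNReal.ofReal (c * t ^ (-(((n : ℝ) + 2) / 2)))) x := by
              intro x
              simp [indicator, hat]
            simp_rw [e]
            rw [indicator_of_mem ht, lintegral_indicator measurableSet_ball, setLIntegral_const,
              Measure.addHaar_ball_of_pos _ _ (Real.sqrt_pos.2 ht0), finrank_euclideanSpace_fin,
              ← hv, mul_right_comm, ← ENNReal.ofReal_mul hc.le, ← mul_assoc,
              ← ENNReal.ofReal_mul (by positivity)]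
            -- The slice at time `t` has volume proportional to `t^(n/2)`, which leaves exactly
            -- `t⁻¹`.
            refine mul_le_mul' (ENNReal.ofReal_le_ofReal (le_of_eq ?_)) le_rfl
            rw [Real.sqrt_eq_rpow, ← Real.rpow_natCast, ← Real.rpow_mul ht0.le, mul_assoc,
              ← Real.rpow_add ht0, ← Real.rpow_neg_one]
            congr 2
            ring
          · rw [indicator_of_notMem ht]
            exact zero_le
  · exact (Measurable.indicator (by fun_prop) hms).aemeasurable

theorem no_solution_of_supercritical (hα : 0 < α) {p lam : ℝ} (hp : 1 ≤ p) (hlam : 1 < lam)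
    (hsup : ((n : ℝ) + 2) / 2 * (1 - 1 / lam) ≤ α) {f : SpaceTime n → ℝ} (hf : f ∈ X n p)
    (hsol : IsNonnegSuperSolution n lam α f) : ∀ᵐ z : SpaceTime n, f z = 0 := by
  by_contra h0
  obtain ⟨b, ρ, hb, hρ, hpos⟩ := exists_le_J hα hf.1 hsol.nonneg h0
  have hlam0 : 0 < lam := by linarith
  set a := max (max (2 * ρ) (ρ ^ 2)) 1 with ha
  have ha1 : 2 * ρ ≤ a := (le_max_left _ _).trans (le_max_left _ _)
  have ha2 : ρ ^ 2 ≤ a := (le_max_right _ _).trans (le_max_left _ _)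
  have ha3 : 1 ≤ a := le_max_right _ _
  -- Where `‖x‖` and `ρ` are at most `√t`, one has `(‖x‖ + ρ)² ≤ 4t`, so the exponential in
  -- `exists_le_J` is at least `exp (-2)`.
  set c := (b * Real.exp (-2)) ^ lam with hc
  have hc0 : 0 < c := by positivity
  set γ := α - 1 - (n : ℝ) / 2 with hγ
  have hγlam : -(((n : ℝ) + 2) / 2) ≤ γ * lam := by
    have : ((n : ℝ) + 2) / 2 * (1 - 1 / lam) * lam ≤ α * lam := by gcongr
    have h2 : ((n : ℝ) + 2) / 2 * (1 - 1 / lam) * lam = ((n : ℝ) + 2) / 2 * (lam - 1) := by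
      field_simp
    rw [hγ]
    linarith
  have hms : MeasurableSet {w : SpaceTime n | a < w.2 ∧ ‖w.1‖ < √w.2} :=
    (measurableSet_lt measurable_const measurable_snd).inter
      (measurableSet_lt measurable_fst.norm measurable_snd.sqrt)
  refine (lintegral_time_pos_lt_top hα hp hlam hsup hf hsol).not_ge ?_
  rw [← lintegral_paraboloid_eq_top n (by linarith : 0 < a) hc0]
  refine le_trans ?_ (lintegral_mono_set (s := {w : SpaceTime n | a < w.2 ∧ ‖w.1‖ < √w.2})
    fun w hw => lt_trans (by linarith) hw.1)
  refine setLIntegral_mono_ae' hms ?_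
  filter_upwards [hsol.super] with z hz hzm
  obtain ⟨hz1, hz2⟩ := hzm
  have hzp : 0 < z.2 := by linarith
  have hJ : ENNReal.ofReal (b * Real.exp (-2) * z.2 ^ γ) ≤ J n α f z := by
    refine le_trans (ENNReal.ofReal_le_ofReal ?_) (hpos z.1 z.2 (by linarith))
    rw [mul_right_comm]
    have h1 : -2 ≤ -(‖z.1‖ + ρ) ^ 2 / (2 * z.2) := by
      rw [le_div_iff₀ (by positivity)]
      have h3 : ρ ≤ √z.2 := Real.le_sqrt_of_sq_le (by linarith)
      have h4 : (‖z.1‖ + ρ) ^ 2 ≤ (√z.2 + √z.2) ^ 2 := by gcongr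
      have h5 := Real.sq_sqrt hzp.le
      nlinarith
    gcongr
  refine le_trans ?_ ((ENNReal.rpow_le_rpow hJ hlam0.le).trans hz)
  rw [ENNReal.ofReal_rpow_of_pos (by positivity), Real.mul_rpow (by positivity) (by positivity),
    ← Real.rpow_mul hzp.le, ← hc]
  refine ENNReal.ofReal_le_ofReal ?_
  have : (1 : ℝ) ≤ z.2 := by linarith
  gcongr

end Superlinear

end FracHeat

theorem theorem3p1 (n : ℕ) (hn : 1 ≤ n) (p α lam : ℝ) (hp : 1 ≤ p) (hα : 0 < α) (hlam : 0 < lam) :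
    (∃ f ∈ FracHeat.X n p, FracHeat.IsNonnegSuperSolution n lam α f ∧
        ¬ (∀ᵐ z : FracHeat.SpaceTime n, f z = 0)) ↔
      (lam, α) ∈ FracHeat.regionB ∪ FracHeat.regionD n p ∪ FracHeat.regionE n p := by
  constructor
  · rintro ⟨f, hf, hsol, h0⟩
    rcases lt_trichotomy lam 1 with h | h | h
    · exact absurd (FracHeat.no_solution_of_lt_one hn hα hp hlam h hf hsol) h0
    · exact .inl (.inl ⟨h, hα⟩)
    · have hlt : α < ((n : ℝ) + 2) / 2 * (1 - 1 / lam) := by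
        by_contra! hge
        exact h0 (FracHeat.no_solution_of_supercritical hα hp h hge hf hsol)
      rcases lt_or_ge α (((n : ℝ) + 2) / (2 * p) * (1 - 1 / lam)) with h1 | h1
      · exact .inr ⟨h, hα, h1⟩
      · exact .inl (.inr ⟨h, h1, hlt⟩)
  · rintro ((⟨h, -⟩ | ⟨h, -, h2⟩) | ⟨h, -, h2⟩)
    · obtain rfl : lam = 1 := h
      exact FracHeat.exists_solution_of_eq_one n hp hα
    · exact FracHeat.exists_solution_of_subcritical n hp hα h h2
    · refine FracHeat.exists_solution_of_subcritical n hp hα h (lt_of_lt_of_le h2 ?_)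
      have h3 : 0 ≤ 1 - 1 / lam := by
        rw [sub_nonneg, div_le_one hlam]; exact le_of_lt h
      change ((n : ℝ) + 2) / (2 * p) * (1 - 1 / lam) ≤ ((n : ℝ) + 2) / 2 * (1 - 1 / lam)
      gcongr
      linarith
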